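/- Propositional inclusion logic ($\mathsf{PINC}$) has the formulas $$\varphi ::= \top \mid \bot \mid x \mid \neg x \mid \varphi\wedge\varphi \mid \varphi\vee\varphi \mid \mathbf{x}\subseteq\mathbf{y},$$ where $x$ is a variable from a countably infinite set $\mathrm{VAR}$ and $\mathbf{x},\mathbf{y}$ are finite tuples of variables of the same length. A team $T$ is a set of assignments $t\colon\mathrm{VAR}\to\{0,1\}$, and $T\models\varphi$ is defined as follows: $T\models\top$ always; $T\models\bot$ iff $T=\emptyset$; $T\models x$ iff $t(x)=1$ for all $t\in T$; $T\models\neg x$ iff $t(x)=0$ for all $t\in T$; $T\models\varphi\wedge\psi$ iff $T\models\varphi$ and $T\models\psi$; $T\models\varphi\vee\psi$ iff $T=T_1\cup T_2$ for some $T_1,T_2$ with $T_1\models\varphi$ and $T_2\models\psi$; $T\models\mathbf{x}\subseteq\mathbf{y}$ iff for every $t\in T$ there is $t'\in T$ with $t(\mathbf{x})=t'(\mathbf{y})$. The operator $\vee$ is called split-junction. A formula is satisfiable if $T\models\varphi$ for some nonempty team $T$. Theorem. The problem to decide, given a $\mathsf{PINC}$-formula $\varphi$ in which no split-junction occurs,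 whether $\varphi$ is satisfiable, is in $\mathsf{P}$: the language of all (encodings of) satisfiable $\mathsf{PINC}$-formulas without split-junctions is decided by a deterministic Turing machine in a number of steps that is polynomial in the length of the input, where formulas are written as words over a finite alphabet in prefix notation and variables are written by their indices in binary. -/

import Mathlib

/-- Formulas of propositional inclusion logic over the variables `x₀, x₁, …`, in negation normal
form. `inc x y` is the inclusion atom `x ⊆ y` for two tuples of the same length; variables may
repeat in a tuple. `or` is the split-junction. -/
inductive PINC : Type
  | top : PINC
  | bot : PINC
  | pos (x : ℕ) : PINC
  | neg (x : ℕ) : PINC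
  | and (φ ψ : PINC) : PINC
  | or (φ ψ : PINC) : PINC
  | inc {n : ℕ} (x y : Fin n → ℕ) : PINC

/-- A team is a set of assignments of truth values to the variables. -/
abbrev PINC.Team : Type := Set (ℕ → Bool)

/-- Team semantics (with lax split-junctions). -/
def PINC.Sat : PINC.Team → PINC → Prop
  | _, .top => True
  | T, .bot => T = ∅
  | T, .pos x => ∀ t ∈ T, t x = true
  | T, .neg x => ∀ t ∈ T, t x = false
  | T, .and φ ψ => PINC.Sat T φ ∧ PINC.Sat T ψ
  | T, .or φ ψ => ∃ T₁ T₂ : PINC.Team, T₁ ∪ T₂ = T ∧ PINC.Sat T₁ φ ∧ PINC.Sat T₂ ψ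
  | T, .inc x y => ∀ t ∈ T, ∃ t' ∈ T, ∀ i, t (x i) = t' (y i)

/-- A formula is satisfiable if some nonempty team satisfies it. -/
def PINC.Satisfiable (φ : PINC) : Prop := ∃ T : PINC.Team, T.Nonempty ∧ PINC.Sat T φ

/-- The number of occurrences of the split-junction in a formula. -/
def PINC.splits : PINC → ℕ
  | .and φ ψ => PINC.splits φ + PINC.splits ψ
  | .or φ ψ => PINC.splits φ + PINC.splits ψ + 1
  | _ => 0

/-- The finite alphabet over which formulas are written. -/
inductive PINCSymbol : Type
  | top | bot | pos | neg | and | or | inc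
  /-- A binary digit of the index of a variable. -/
  | bit (b : Bool)
  /-- End of the index of a variable. -/
  | endVar
  /-- End of an inclusion atom. -/
  | endInc
  deriving DecidableEq, Fintype

/-- A variable is written as its index in binary, followed by an end marker. -/
def PINC.encodeVar (x : ℕ) : List PINCSymbol :=
  (Computability.encodeNat x).map PINCSymbol.bit ++ [PINCSymbol.endVar]

/-- Formulas are written in prefix notation. The inclusion atom `x₁ … xₙ ⊆ y₁ … yₙ` is written as
the word `inc x₁ y₁ x₂ y₂ … xₙ yₙ endInc`. -/
def PINC.encode : PINC → List PINCSymbol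
  | .top => [.top]
  | .bot => [.bot]
  | .pos x => .pos :: PINC.encodeVar x
  | .neg x => .neg :: PINC.encodeVar x
  | .and φ ψ => .and :: (PINC.encode φ ++ PINC.encode ψ)
  | .or φ ψ => .or :: (PINC.encode φ ++ PINC.encode ψ)
  | .inc x y =>
      .inc :: ((List.ofFn fun i => PINC.encodeVar (x i) ++ PINC.encodeVar (y i)).flatten
        ++ [.endInc])

/-- Satisfiability of formulas without split-junctions, as a formal language: the set of all words
that are the encoding of a satisfiable formula in which no split-junction occurs. -/
def PINC.splitFreeSAT : Language PINCSymbol :=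
  {w | ∃ φ : PINC, φ.splits = 0 ∧ φ.Satisfiable ∧ φ.encode = w}

/-- The complexity class P: a language over a finite alphabet is in P if a deterministic
(multi-stack) Turing machine decides, for every word `w` over the alphabet, whether `w` is in the
language, in a number of steps that is bounded by a polynomial in the length of `w`. -/
def InPTime {Γ : Type} [Fintype Γ] (L : Language Γ) : Prop :=
  ∃ f : List Γ → Bool, (∀ w, f w = true ↔ w ∈ L) ∧
    Nonempty (Turing.TM2ComputableInPolyTime (fun w : List Γ => w) Computability.encodeBool f)

/-! The encoding is uniquely readable. -/

theorem PINC.encodeVar_append_inj {x y : ℕ} {u v : List PINCSymbol}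
    (h : PINC.encodeVar x ++ u = PINC.encodeVar y ++ v) : x = y ∧ u = v := by
  have key : ∀ a b : List Bool, a.map PINCSymbol.bit ++ PINCSymbol.endVar :: u
      = b.map PINCSymbol.bit ++ PINCSymbol.endVar :: v → a = b ∧ u = v := by
    intro a
    induction a with
    | nil => intro b hb; cases b <;> simp_all
    | cons c a ih =>
      intro b hb
      cases b with
      | nil => simp at hb
      | cons d b =>
        simp only [List.map_cons, List.cons_append, List.cons.injEq, PINCSymbol.bit.injEq] at hb
        have := ih b hb.2
        simp_all
  have h' := key _ _ (by simpa [PINC.encodeVar] using h)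
  exact ⟨Computability.encodingNatBool.encode_injective h'.1, h'.2⟩

theorem PINC.encodePairs_append_inj : ∀ (l m : List (ℕ × ℕ)) (u v : List PINCSymbol),
    (l.map fun p => PINC.encodeVar p.1 ++ PINC.encodeVar p.2).flatten ++ .endInc :: u
      = (m.map fun p => PINC.encodeVar p.1 ++ PINC.encodeVar p.2).flatten ++ .endInc :: v →
    l = m ∧ u = v := by
  have ne : ∀ (x : ℕ) (w v : List PINCSymbol), PINC.encodeVar x ++ w ≠ .endInc :: v := by
    intro x w v
    unfold PINC.encodeVar
    cases Computability.encodeNat x <;> simp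
  intro l
  induction l with
  | nil =>
    intro m u v h
    cases m with
    | nil => simpa using h
    | cons q m =>
      simp only [List.map_nil, List.flatten_nil, List.nil_append, List.map_cons,
        List.flatten_cons, List.append_assoc] at h
      exact absurd h.symm (ne _ _ _)
  | cons p l ih =>
    intro m u v h
    cases m with
    | nil =>
      simp only [List.map_nil, List.flatten_nil, List.nil_append, List.map_cons,
        List.flatten_cons, List.append_assoc] at h
      exact absurd h (ne _ _ _)
    | cons q m =>
      simp only [List.map_cons, List.flatten_cons, List.append_assoc] at h
      obtain ⟨h1, h⟩ := PINC.encodeVar_append_inj h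
      obtain ⟨h2, h⟩ := PINC.encodeVar_append_inj h
      obtain ⟨h3, h⟩ := ih m u v h
      exact ⟨by rw [h3, Prod.ext h1 h2], h⟩

theorem PINC.encode_append_inj : ∀ (φ ψ : PINC) (u v : List PINCSymbol),
    φ.encode ++ u = ψ.encode ++ v → φ = ψ ∧ u = v := by
  intro φ
  induction φ with
  | top =>
    intro ψ u v h
    cases ψ <;> simp [PINC.encode] at h
    exact ⟨rfl, h⟩
  | bot =>
    intro ψ u v h
    cases ψ <;> simp [PINC.encode] at h
    exact ⟨rfl, h⟩
  | pos x =>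
    intro ψ u v h
    cases ψ <;> simp [PINC.encode] at h
    simpa using PINC.encodeVar_append_inj h
  | neg x =>
    intro ψ u v h
    cases ψ <;> simp [PINC.encode] at h
    simpa using PINC.encodeVar_append_inj h
  | and φ ψ ih₁ ih₂ =>
    intro χ u v h
    cases χ <;> simp [PINC.encode] at h
    obtain ⟨h1, h⟩ := ih₁ _ _ _ h
    obtain ⟨h2, h⟩ := ih₂ _ _ _ h
    exact ⟨by rw [h1, h2], h⟩
  | or φ ψ ih₁ ih₂ =>
    intro χ u v h
    cases χ <;> simp [PINC.encode] at h
    obtain ⟨h1, h⟩ := ih₁ _ _ _ h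
    obtain ⟨h2, h⟩ := ih₂ _ _ _ h
    exact ⟨by rw [h1, h2], h⟩
  | @inc n x y =>
    intro ψ u v h
    cases ψ with
    | @inc m x' y' =>
      simp only [PINC.encode, List.cons_append, List.cons.injEq, true_and, List.append_assoc,
        List.nil_append] at h
      have e : ∀ {k : ℕ} (a b : Fin k → ℕ),
          (List.ofFn fun i => PINC.encodeVar (a i) ++ PINC.encodeVar (b i))
          = (List.ofFn fun i => (a i, b i)).map
            fun p => PINC.encodeVar p.1 ++ PINC.encodeVar p.2 := by
        intro k a b
        rw [List.map_ofFn]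
        rfl
      rw [e, e] at h
      obtain ⟨h1, h2⟩ := PINC.encodePairs_append_inj _ _ _ _ h
      have hn : n = m := by simpa using congrArg List.length h1
      subst hn
      have h3 := List.ofFn_injective h1
      have hx : x = x' := funext fun i => congrArg Prod.fst (congrFun h3 i)
      have hy : y = y' := funext fun i => congrArg Prod.snd (congrFun h3 i)
      exact ⟨by rw [hx, hy], h2⟩
    | _ => simp [PINC.encode] at h

theorem PINC.encode_injective : Function.Injective PINC.encode := fun φ ψ h =>
  (PINC.encode_append_inj φ ψ [] [] (by rw [h])).1

/-! ### Structured programs on four stacks of bits -/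

open Turing StateTransition

namespace StackProg

/-! Without split-junctions a formula is a conjunction of inclusion atoms, once the truth values 0
and 1 may occur as entries: `x` is `x ⊆ 1`, `¬x` is `x ⊆ 0` and `⊥` is `0 ⊆ 1` (`sat_iff_atomSat`).
Such atoms force equalities between names (variables and truth values) at every assignment of the
team: equality is an equivalence relation, and if an atom pairs `u` with `x` and `v` with `y`, and
`x = y` is forced, then `u = v` is forced.

If `0 = 1` is forced, no nonempty team exists. Otherwise the team of all assignments that respect
the forced equalities is nonempty and satisfies every atom: for `t` in it, let `t'` be true exactly
on the names forced equal to a right entry whose left entry is true under `t` (`exists_team_iff`).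
The pairs of names are quadratically many in the number of entries, and a round that adds no pair is
a fixed point, so polynomially many rounds yield all forced equalities (`deriveRound_closure`).

To run this on a Turing machine, programs on stacks of bits are compiled into machine code
(`Runs.reachesIn`). Data are binary trees, kept on a stack in prefix code. The functions computed in
polynomial time (`PolyFun`) are closed under composition, pairing, case distinction and folds whose
intermediate values stay polynomially bounded; `inPTime_of_polyFun` turns them into machines.
Loading the input on a stack reverses it, so the parser works from right to left. There a connective
follows its arguments, and a count of the complete formulas suffices for parsing (`accept_run_iff`).
-/

/-- The four stacks: a main stack `M`, two auxiliary stacks `B`, `C`, and a counter `N`. -/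
inductive Stk : Type
  | M | B | C | N
  deriving DecidableEq

instance : Fintype Stk := ⟨{.M, .B, .C, .N}, by intro k; cases k <;> simp⟩

/-- The contents of the four stacks. -/
abbrev Store : Type := Stk → List Bool

/-- Structured programs. `pop k p` removes the top of the stack `k` and continues with `p`
applied to the removed bit; `loop k p` repeats this until `k` is found empty. -/
inductive Prog : Type
  | skip : Prog
  | push (k : Stk) (b : Bool) : Prog
  | seq (p q : Prog) : Prog
  | pop (k : Stk) (p : Option Bool → Prog) : Prog
  | loop (k : Stk) (p : Bool → Prog) : Prog

/-- `Runs p s n s'` says that `p` started in `s` terminates in `s'` after at most `n` steps. -/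
inductive Runs : Prog → Store → ℕ → Store → Prop
  | skip (s : Store) : Runs .skip s 0 s
  | push (k : Stk) (b : Bool) (s : Store) :
      Runs (.push k b) s 1 (Function.update s k (b :: s k))
  | seq {p q : Prog} {s s' s'' : Store} {m n : ℕ} :
      Runs p s m s' → Runs q s' n s'' → Runs (.seq p q) s (m + n) s''
  | pop {k : Stk} {p : Option Bool → Prog} {s s' : Store} {n : ℕ} :
      Runs (p (s k).head?) (Function.update s k (s k).tail) n s' → Runs (.pop k p) s (n + 1) s'
  | loop_nil {k : Stk} {p : Bool → Prog} {s : Store} : s k = [] → Runs (.loop k p) s 1 s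
  | loop_cons {k : Stk} {p : Bool → Prog} {s s' s'' : Store} {b : Bool} {l : List Bool}
      {m n : ℕ} : s k = b :: l → Runs (p b) (Function.update s k l) m s' →
      Runs (.loop k p) s' n s'' → Runs (.loop k p) s (m + n + 1) s''
  | mono {p : Prog} {s s' : Store} {m n : ℕ} : Runs p s m s' → m ≤ n → Runs p s n s'

/-- The total number of bits in a store. -/
def Store.size (s : Store) : ℕ := ∑ k, (s k).length

theorem Store.size_update (s : Store) (k : Stk) (l : List Bool) :
    Store.size (Function.update s k l) + (s k).length = Store.size s + l.length := by
  have h (t : Store) : Store.size t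
      = (t .M).length + ((t .B).length + ((t .C).length + ((t .N).length + 0))) := rfl
  rw [h, h]
  cases k <;> simp <;> omega

/-- A step pushes at most one bit. Time bounds are thereby also size bounds, which is what makes
polynomial bounds compose. -/
theorem Runs.size_le {p : Prog} {s s' : Store} {n : ℕ} (h : Runs p s n s') :
    s'.size ≤ s.size + n := by
  induction h with
  | skip => simp
  | push k b s => have := s.size_update k (b :: s k); simp at this; omega
  | seq => omega
  | @pop k p s _ _ _ ih => have := s.size_update k (s k).tail; simp at this; omega
  | loop_nil => omega
  | @loop_cons k p s _ _ b l _ _ e _ _ _ _ =>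
    have := s.size_update k l; simp [e] at this; omega
  | mono => omega

/-! ### Compilation into a Turing machine -/

/-- The control points of a program. -/
def Prog.Label : Prog → Type
  | .skip => Empty
  | .push _ _ => Unit
  | .seq p q => p.Label ⊕ q.Label
  | .pop _ p => Option (Σ o, (p o).Label)
  | .loop _ p => Option (Σ b, (p b).Label)

noncomputable instance Prog.instFintypeLabel : (p : Prog) → Fintype p.Label
  | .skip => inferInstanceAs (Fintype Empty)
  | .push _ _ => inferInstanceAs (Fintype Unit)
  | .seq p q =>
    letI := Prog.instFintypeLabel p
    letI := Prog.instFintypeLabel q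
    inferInstanceAs (Fintype (p.Label ⊕ q.Label))
  | .pop _ p =>
    letI := fun o => Prog.instFintypeLabel (p o)
    inferInstanceAs (Fintype (Option (Σ o, (p o).Label)))
  | .loop _ p =>
    letI := fun b => Prog.instFintypeLabel (p b)
    inferInstanceAs (Fintype (Option (Σ b, (p b).Label)))

/-- The stack alphabets of the machine: the input stack `none` and the stacks of bits. -/
def StackType (Γ : Type) : Option Stk → Type
  | none => Γ
  | some _ => Bool

/-- The state of the machine holds the symbol that was popped last. -/
abbrev State (Γ : Type) : Type := Option (Bool ⊕ Γ)

/-- The first control point of a program, if its control points are embedded by `i` and `e` is the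
control point that follows the program. -/
def Prog.start {L : Type} : (p : Prog) → (p.Label → L) → L → L
  | .skip, _, e => e
  | .push _ _, i, _ => i ()
  | .seq p q, i, e => p.start (fun l => i (.inl l)) (q.start (fun l => i (.inr l)) e)
  | .pop _ _, i, _ => i none
  | .loop _ _, i, _ => i none

/-- The machine code at each control point of a program. -/
def Prog.code {L Γ : Type} : (p : Prog) → (p.Label → L) → L → p.Label →
    TM2.Stmt (StackType Γ) L (State Γ)
  | .push k b, _, e, _ => .push (some k) (fun _ => b) (.goto fun _ => e)
  | .seq p q, i, e, .inl l =>
      p.code (fun l => i (.inl l)) (q.start (fun l => i (.inr l)) e) l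
  | .seq _ q, i, e, .inr l => q.code (fun l => i (.inr l)) e l
  | .pop k p, i, e, none =>
      .pop (some k) (fun _ r => Option.map Sum.inl r) (.goto fun v =>
        let o := v.bind Sum.getLeft?
        (p o).start (fun l => i (some ⟨o, l⟩)) e)
  | .pop _ p, i, e, some ⟨o, l⟩ => (p o).code (fun l => i (some ⟨o, l⟩)) e l
  | .loop k p, i, e, none =>
      .pop (some k) (fun _ r => Option.map Sum.inl r) (.goto fun v =>
        match v.bind Sum.getLeft? with
        | none => e
        | some b => (p b).start (fun l => i (some ⟨b, l⟩)) (i none))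
  | .loop _ p, i, _, some ⟨b, l⟩ => (p b).code (fun l => i (some ⟨b, l⟩)) (i none) l

/-- The stacks of the machine for a given input stack and store. -/
def contents {Γ : Type} (w : List Γ) (s : Store) : (k : Option Stk) → List (StackType Γ k)
  | none => w
  | some k => s k

@[simp]
theorem contents_some {Γ : Type} (w : List Γ) (s : Store) (k : Stk) :
    contents w s (some k) = s k := rfl

theorem update_contents {Γ : Type} (w : List Γ) (s : Store) (k : Stk) (l : List Bool) :
    Function.update (contents w s) (some k) l = contents w (Function.update s k l) := by
  funext j
  match j with
  | none => exact Function.update_of_ne (by simp) _ _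
  | some j =>
    by_cases h : j = k
    · subst h
      exact (Function.update_self ..).trans (Function.update_self j l s).symm
    · exact (Function.update_of_ne (by simpa using h) _ _).trans
        (Function.update_of_ne h _ _).symm

theorem update_contents_none {Γ : Type} (w v : List Γ) (s : Store) :
    Function.update (contents w s) none v = contents v s := by
  funext j
  match j with
  | none => exact Function.update_self ..
  | some j => exact Function.update_of_ne (by simp) _ _

/-- Reachability of a configuration in at most a given number of steps. -/
abbrev ReachesIn {L Γ : Type} (m : L → TM2.Stmt (StackType Γ) L (State Γ))
    (a b : TM2.Cfg (StackType Γ) L (State Γ)) (n : ℕ) : Prop :=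
  Nonempty (EvalsToInTime (TM2.step m) a (some b) n)

theorem ReachesIn.trans {L Γ : Type} {m : L → TM2.Stmt (StackType Γ) L (State Γ)}
    {a b c : TM2.Cfg (StackType Γ) L (State Γ)} {n₁ n₂ : ℕ} (h₁ : ReachesIn m a b n₁)
    (h₂ : ReachesIn m b c n₂) : ReachesIn m a c (n₁ + n₂) := by
  obtain ⟨h₁⟩ := h₁
  obtain ⟨h₂⟩ := h₂
  exact ⟨add_comm n₂ n₁ ▸ EvalsToInTime.trans _ _ _ _ _ _ h₁ h₂⟩

theorem ReachesIn.step {L Γ : Type} {m : L → TM2.Stmt (StackType Γ) L (State Γ)}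
    {l : L} {v : State Γ} {S : ∀ k, List (StackType Γ k)}
    {b : TM2.Cfg (StackType Γ) L (State Γ)} (h : TM2.stepAux (m l) v S = b) :
    ReachesIn m ⟨some l, v, S⟩ b 1 :=
  ⟨⟨⟨1, by rw [← h]; rfl⟩, le_rfl⟩⟩

theorem ReachesIn.refl {L Γ : Type} (m : L → TM2.Stmt (StackType Γ) L (State Γ))
    (a : TM2.Cfg (StackType Γ) L (State Γ)) : ReachesIn m a a 0 := ⟨EvalsToInTime.refl _ _⟩

theorem ReachesIn.mono {L Γ : Type} {m : L → TM2.Stmt (StackType Γ) L (State Γ)}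
    {a b : TM2.Cfg (StackType Γ) L (State Γ)} {n n' : ℕ} (h : ReachesIn m a b n)
    (hn : n ≤ n') : ReachesIn m a b n' := by
  obtain ⟨h⟩ := h
  exact ⟨⟨h.toEvalsTo, h.steps_le_m.trans hn⟩⟩

/-- A machine that contains the code of a program simulates it. -/
theorem Runs.reachesIn {L Γ : Type} {m : L → TM2.Stmt (StackType Γ) L (State Γ)} (w : List Γ)
    {p : Prog} {s s' : Store} {n : ℕ} (h : Runs p s n s') :
    ∀ (i : p.Label → L) (e : L), (∀ l, m (i l) = p.code i e l) → ∀ v, ∃ v',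
      ReachesIn m ⟨some (p.start i e), v, contents w s⟩ ⟨some e, v', contents w s'⟩ n := by
  induction h with
  | skip s => exact fun i e _ v => ⟨v, ReachesIn.refl _ _⟩
  | push k b s =>
    intro i e hm v
    refine ⟨v, ReachesIn.step ?_⟩
    refine (congrArg (fun q => TM2.stepAux q v (contents w s)) (hm ())).trans ?_
    exact congrArg (TM2.Cfg.mk (some e) v) (update_contents w s k (b :: s k))
  | seq _ _ ih₁ ih₂ =>
    intro i e hm v
    obtain ⟨v₁, h₁⟩ := ih₁ _ _ (fun l => hm (.inl l)) v
    obtain ⟨v₂, h₂⟩ := ih₂ _ _ (fun l => hm (.inr l)) v₁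
    exact ⟨v₂, h₁.trans h₂⟩
  | @pop k p s s' n _ ih =>
    intro i e hm v
    obtain ⟨v', h⟩ := ih _ e (fun l => hm (some ⟨_, l⟩)) (Option.map Sum.inl (s k).head?)
    refine ⟨v', add_comm 1 n ▸ (ReachesIn.step ?_).trans h⟩
    refine (congrArg (fun q => TM2.stepAux q v (contents w s)) (hm none)).trans ?_
    -- The state keeps the popped bit as `Sum.inl`; the branch reads it back.
    have ho : (Option.map (Sum.inl (β := Γ)) (s k).head?).bind Sum.getLeft? = (s k).head? := by
      cases (s k).head? <;> rfl
    refine (congrArg (TM2.Cfg.mk (some ((p ((Option.map Sum.inl (s k).head?).bind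
      Sum.getLeft?)).start (fun l => i (some ⟨_, l⟩)) e)) _) (update_contents w s k _)).trans ?_
    rw [ho]
    rfl
  | @loop_nil k p s hs =>
    intro i e hm v
    refine ⟨none, ReachesIn.step ?_⟩
    refine (congrArg (fun q => TM2.stepAux q v (contents w s)) (hm none)).trans ?_
    simp only [Prog.code, TM2.stepAux, contents_some, hs]
    refine (congrArg (TM2.Cfg.mk (some e) none) (update_contents w s k [])).trans ?_
    rw [← hs, Function.update_eq_self]
  | @loop_cons k p s s' s'' b l n₁ n₂ hs _ _ ih₁ ih₂ =>
    intro i e hm v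
    -- The body is followed by the head of its own loop, hence the exit `i none`.
    obtain ⟨v₁, h₁⟩ := ih₁ _ (i none) (fun l => hm (some ⟨_, l⟩)) (some (.inl b))
    obtain ⟨v₂, h₂⟩ := ih₂ i e hm v₁
    refine ⟨v₂, add_comm 1 (n₁ + n₂) ▸ (ReachesIn.step ?_).trans (h₁.trans h₂)⟩
    refine (congrArg (fun q => TM2.stepAux q v (contents w s)) (hm none)).trans ?_
    simp only [Prog.code, TM2.stepAux, contents_some, hs]
    exact congrArg (TM2.Cfg.mk (some _) _) (update_contents w s k l)
  | mono _ hn ih =>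
    intro i e hm v
    obtain ⟨v', h⟩ := ih i e hm v
    exact ⟨v', h.mono hn⟩

end StackProg

/-! ### Binary trees on a stack -/

namespace StackProg

/-- Binary trees, the data on which programs operate. -/
inductive BTree : Type
  | nil : BTree
  | node (l r : BTree) : BTree
  deriving DecidableEq

namespace BTree

/-- The prefix code of a tree. -/
def code : BTree → List Bool
  | nil => [false]
  | node l r => true :: (l.code ++ r.code)

/-- The length of the prefix code of a tree. -/
def size : BTree → ℕ
  | nil => 1
  | node l r => l.size + r.size + 1

@[simp]
theorem length_code (x : BTree) : x.code.length = x.size := by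
  induction x with
  | nil => rfl
  | node l r hl hr => simp [code, size, hl, hr]

theorem one_le_size (x : BTree) : 1 ≤ x.size := by
  cases x <;> simp [size]

theorem code_append_inj : ∀ {x y : BTree} {u v : List Bool},
    x.code ++ u = y.code ++ v → x = y ∧ u = v
  | nil, nil, _, _, h => ⟨rfl, by simpa [code] using h⟩
  | nil, node _ _, _, _, h => by simp [code] at h
  | node _ _, nil, _, _, h => by simp [code] at h
  | node l r, node l' r', u, v, h => by
    simp only [code, List.cons_append, List.append_assoc, List.cons.injEq, true_and] at h
    obtain ⟨hl, h⟩ := code_append_inj h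
    obtain ⟨hr, h⟩ := code_append_inj h
    exact ⟨by rw [hl, hr], h⟩

theorem code_injective : Function.Injective code := fun x y h =>
  (code_append_inj (u := []) (v := []) (by rw [h])).1

/-- The left subtree. -/
def left : BTree → BTree
  | nil => nil
  | node l _ => l

/-- The right subtree. -/
def right : BTree → BTree
  | nil => nil
  | node _ r => r

/-- The tree that represents a truth value. -/
def ofBool : Bool → BTree
  | false => nil
  | true => node nil nil

end BTree

/-- One of the two auxiliary stacks. -/
def aux (k : Bool) : Stk := bif k then .B else .C

/-- The store with the main stack `m`, the auxiliary stacks `l` (the one given by `k`) and `o`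
(the other one), and the counter `n`. -/
def store (k : Bool) (m l o n : List Bool) : Store
  | .M => m
  | .B => bif k then l else o
  | .C => bif k then o else l
  | .N => n

section store

variable (k : Bool) (m l o n x : List Bool)

@[simp] theorem store_M : store k m l o n .M = m := rfl
@[simp] theorem store_N : store k m l o n .N = n := rfl
@[simp] theorem store_aux : store k m l o n (aux k) = l := by cases k <;> rfl

/-- By this symmetry, facts about the stack `aux k` carry over to the other auxiliary stack. -/
theorem store_swap : store k m l o n = store (!k) m o l n := by
  funext j; cases j <;> cases k <;> rfl

@[simp] theorem update_store_M :
    Function.update (store k m l o n) .M x = store k x l o n := by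
  funext j; cases j <;> rfl

@[simp] theorem update_store_N :
    Function.update (store k m l o n) .N x = store k m l o x := by
  funext j; cases j <;> rfl

@[simp] theorem update_store_aux :
    Function.update (store k m l o n) (aux k) x = store k m x o n := by
  funext j; cases k <;> cases j <;> rfl

end store

namespace Runs

theorem pushM (k b : Bool) (m l o n : List Bool) :
    Runs (.push .M b) (store k m l o n) 1 (store k (b :: m) l o n) := by
  simpa using Runs.push .M b (store k m l o n)

theorem pushN (k b : Bool) (m l o n : List Bool) :
    Runs (.push .N b) (store k m l o n) 1 (store k m l o (b :: n)) := by
  simpa using Runs.push .N b (store k m l o n)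

theorem pushAux (k b : Bool) (m l o n : List Bool) :
    Runs (.push (aux k) b) (store k m l o n) 1 (store k m (b :: l) o n) := by
  simpa using Runs.push (aux k) b (store k m l o n)

theorem popM {k : Bool} {m l o n : List Bool} {p : Option Bool → Prog} {s : Store} {t : ℕ}
    (h : Runs (p m.head?) (store k m.tail l o n) t s) :
    Runs (.pop .M p) (store k m l o n) (t + 1) s :=
  Runs.pop (by simpa using h)

theorem popN {k : Bool} {m l o n : List Bool} {p : Option Bool → Prog} {s : Store} {t : ℕ}
    (h : Runs (p n.head?) (store k m l o n.tail) t s) :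
    Runs (.pop .N p) (store k m l o n) (t + 1) s :=
  Runs.pop (by simpa using h)

theorem popAux {k : Bool} {m l o n : List Bool} {p : Option Bool → Prog} {s : Store} {t : ℕ}
    (h : Runs (p l.head?) (store k m l.tail o n) t s) :
    Runs (.pop (aux k) p) (store k m l o n) (t + 1) s :=
  Runs.pop (by simpa using h)

theorem loopN_cons {k b : Bool} {m l o n : List Bool} {p : Bool → Prog} {s s' : Store}
    {t t' : ℕ} (h : Runs (p b) (store k m l o n) t s) (h' : Runs (.loop .N p) s t' s') :
    Runs (.loop .N p) (store k m l o (b :: n)) (t + t' + 1) s' :=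
  Runs.loop_cons (store_N ..) (by simpa using h) h'

theorem loopAux_cons {k b : Bool} {m l o n : List Bool} {p : Bool → Prog} {s s' : Store}
    {t t' : ℕ} (h : Runs (p b) (store k m l o n) t s) (h' : Runs (.loop (aux k) p) s t' s') :
    Runs (.loop (aux k) p) (store k m (b :: l) o n) (t + t' + 1) s' :=
  Runs.loop_cons (store_aux ..) (by simpa using h) h'

theorem loopN_nil {k : Bool} {m l o : List Bool} {p : Bool → Prog} :
    Runs (.loop .N p) (store k m l o []) 1 (store k m l o []) :=
  Runs.loop_nil (store_N ..)

theorem loopAux_nil {k : Bool} {m o n : List Bool} {p : Bool → Prog} :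
    Runs (.loop (aux k) p) (store k m [] o n) 1 (store k m [] o n) :=
  Runs.loop_nil (store_aux ..)

end Runs

namespace Prog

/-- The body of the loop that moves a tree from the main stack to an auxiliary stack; the counter
holds the number of trees that still have to be read. -/
def scanBody (k : Bool) : Prog :=
  .pop .M fun
    | none => .skip
    | some false => .push (aux k) false
    | some true => .seq (.push (aux k) true) (.seq (.push .N true) (.push .N true))

/-- Move the topmost tree from the main stack to an auxiliary stack. -/
def scan (k : Bool) : Prog :=
  .seq (.push .N true) (.loop .N fun _ => scanBody k)

/-- Move everything from an auxiliary stack to the main stack. -/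
def restore (k : Bool) : Prog := .loop (aux k) fun b => .push .M b

/-- Move everything from an auxiliary stack to the other one. -/
def transfer (k : Bool) : Prog := .loop (aux k) fun b => .push (aux !k) b

/-- Empty an auxiliary stack. -/
def clear (k : Bool) : Prog := .loop (aux k) fun _ => .skip

/-- Duplicate an auxiliary stack to the main stack and the other auxiliary stack. -/
def fork (k : Bool) : Prog :=
  .loop (aux k) fun b => .seq (.push .M b) (.push (aux !k) b)

/-- Remove the topmost tree. -/
def drop : Prog := .seq (scan true) (clear true)

/-- Duplicate the topmost tree. -/
def dup : Prog :=
  .seq (scan true) (.seq (fork true) (.seq (transfer false) (restore true)))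

/-- Exchange the two topmost trees. -/
def swap : Prog :=
  .seq (scan true) (.seq (scan false) (.seq (restore true) (restore false)))

/-- Remove the second tree. -/
def nip : Prog :=
  .seq (scan true) (.seq (scan false) (.seq (clear false) (restore true)))

/-- Push bits on the main stack. -/
def pushAll : List Bool → Prog
  | [] => .skip
  | b :: l => .seq (pushAll l) (.push .M b)

end Prog

/-! ### Correctness and running time of the stack operations -/

namespace Runs

/-- In prefix code a leaf completes one pending tree, and an inner node replaces one pending tree by
two. The arbitrary continuation of the loop allows the induction to read both subtrees within a
single loop. -/
theorem scan_loop (k : Bool) (x : BTree) : ∀ (m l o n : List Bool) (t : ℕ) (s : Store),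
    Runs (.loop .N fun _ => Prog.scanBody k) (store k m (x.code.reverse ++ l) o n) t s →
    Runs (.loop .N fun _ => Prog.scanBody k) (store k (x.code ++ m) l o (true :: n))
      (5 * x.size + t) s := by
  induction x with
  | nil =>
    intro m l o n t s h
    refine Runs.mono (Runs.loopN_cons (Runs.popM ?_) h) (m := (1 + 1) + t + 1) ?_
    · exact Runs.pushAux ..
    · simp only [BTree.size]; omega
  | node x y hx hy =>
    intro m l o n t s h
    refine Runs.mono (Runs.loopN_cons (Runs.popM ?_) (hx (y.code ++ m) (true :: l) o (true :: n)
      _ s (hy _ _ _ _ t s ?_))) (m := (1 + (1 + 1) + 1) + (5 * x.size + (5 * y.size + t)) + 1) ?_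
    · have h1 := Runs.pushAux k true (x.code ++ (y.code ++ m)) l o n
      have h2 := Runs.pushN k true (x.code ++ (y.code ++ m)) (true :: l) o n
      have h3 := Runs.pushN k true (x.code ++ (y.code ++ m)) (true :: l) o (true :: n)
      simpa [BTree.code] using h1.seq (h2.seq h3)
    · simpa [BTree.code] using h
    · simp [BTree.size]; omega

theorem scan (k : Bool) (x : BTree) (m l o : List Bool) :
    Runs (Prog.scan k) (store k (x.code ++ m) l o []) (5 * x.size + 2)
      (store k m (x.code.reverse ++ l) o []) :=
  ((Runs.pushN ..).seq (scan_loop k x m l o [] 1 _ Runs.loopN_nil)).mono (by omega)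

theorem restore (k : Bool) : ∀ (l m o n : List Bool),
    Runs (Prog.restore k) (store k m l o n) (2 * l.length + 1)
      (store k (l.reverse ++ m) [] o n)
  | [], _, _, _ => Runs.loopAux_nil
  | b :: l, m, o, n => by
    have h := restore k l (b :: m) o n
    simpa [Prog.restore] using (Runs.loopAux_cons (Runs.pushM k b m l o n) h).mono
      (n := 2 * (l.length + 1) + 1) (by omega)

theorem transfer (k : Bool) : ∀ (l m o n : List Bool),
    Runs (Prog.transfer k) (store k m l o n) (2 * l.length + 1)
      (store k m [] (l.reverse ++ o) n)
  | [], _, _, _ => Runs.loopAux_nil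
  | b :: l, m, o, n => by
    have h := transfer k l m (b :: o) n
    have h1 := Runs.pushAux (!k) b m o l n
    rw [store_swap, store_swap (!k), Bool.not_not] at h1
    simpa [Prog.transfer] using (Runs.loopAux_cons h1 h).mono
      (n := 2 * (l.length + 1) + 1) (by omega)

theorem clear (k : Bool) : ∀ (l m o n : List Bool),
    Runs (Prog.clear k) (store k m l o n) (l.length + 1) (store k m [] o n)
  | [], _, _, _ => Runs.loopAux_nil
  | b :: l, m, o, n =>
    (Runs.loopAux_cons (Runs.skip _) (clear k l m o n)).mono (by simp)

theorem fork (k : Bool) : ∀ (l m o n : List Bool),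
    Runs (Prog.fork k) (store k m l o n) (3 * l.length + 1)
      (store k (l.reverse ++ m) [] (l.reverse ++ o) n)
  | [], _, _, _ => Runs.loopAux_nil
  | b :: l, m, o, n => by
    have h := fork k l (b :: m) (b :: o) n
    have h1 := Runs.pushAux (!k) b (b :: m) o l n
    rw [store_swap, store_swap (!k), Bool.not_not] at h1
    simpa [Prog.fork] using (Runs.loopAux_cons ((Runs.pushM k b m l o n).seq h1) h).mono
      (n := 3 * (l.length + 1) + 1) (by omega)

/-- The store with main stack `m` and no other contents. -/
abbrev onM (m : List Bool) : Store := store true m [] [] []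

theorem drop (x : BTree) (m : List Bool) :
    Runs Prog.drop (onM (x.code ++ m)) (6 * x.size + 3) (onM m) := by
  have h := (scan true x m [] []).seq (clear true _ m [] [])
  exact h.mono (by simp; omega)

/-- Moving a stack reverses it. `fork` restores the tree to the main stack and leaves a copy on the
other auxiliary stack, whose two further moves restore its order. -/
theorem dup (x : BTree) (m : List Bool) :
    Runs Prog.dup (onM (x.code ++ m)) (12 * x.size + 5) (onM (x.code ++ (x.code ++ m))) := by
  have h1 := scan true x m [] []
  have h2 := fork true (x.code.reverse ++ []) m [] []
  have h3 := transfer false ((x.code.reverse ++ []).reverse ++ [])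
    ((x.code.reverse ++ []).reverse ++ m) [] []
  rw [store_swap, store_swap false, Bool.not_false] at h3
  have h4 := restore true (((x.code.reverse ++ []).reverse ++ []).reverse ++ [])
    ((x.code.reverse ++ []).reverse ++ m) [] []
  have h := (h1.seq (h2.seq (h3.seq h4))).mono (n := 12 * x.size + 5) (by simp; omega)
  simpa [Prog.dup] using h

theorem scan_scan (x y : BTree) (m : List Bool) :
    Runs (.seq (Prog.scan true) (Prog.scan false)) (onM (x.code ++ (y.code ++ m)))
      (5 * x.size + 2 + (5 * y.size + 2)) (store true m x.code.reverse y.code.reverse []) := by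
  have h1 := scan true x (y.code ++ m) [] []
  have h2 := scan false y m [] (x.code.reverse ++ [])
  rw [store_swap, store_swap false, Bool.not_false] at h2
  simpa using h1.seq h2

/-- The constructor `mono` may occur at every level, so inverting a run takes an induction rather
than a case split. -/
theorem seq_assoc {p q r : Prog} {s s' : Store} {t : ℕ} (h : Runs (.seq (.seq p q) r) s t s') :
    Runs (.seq p (.seq q r)) s t s' := by
  generalize hp : Prog.seq (.seq p q) r = pp at h
  induction h with
  | @seq a b u v w m n h1 h2 ih1 ih2 =>
    cases hp
    clear ih1 ih2
    generalize hp : Prog.seq p q = pp at h1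
    induction h1 generalizing n with
    | @seq a b u v w m n h3 h4 ih1 ih2 =>
      cases hp
      exact (h3.seq (h4.seq h2)).mono (by omega)
    | mono _ hn ih => exact (ih h2 hp).mono (by omega)
    | _ => cases hp
  | mono _ hn ih => exact (ih hp).mono hn
  | _ => cases hp

theorem swap (x y : BTree) (m : List Bool) :
    Runs Prog.swap (onM (x.code ++ (y.code ++ m))) (7 * (x.size + y.size) + 6)
      (onM (y.code ++ (x.code ++ m))) := by
  have h1 := restore true x.code.reverse m y.code.reverse []
  have h2 := restore false y.code.reverse (x.code.reverse.reverse ++ m) [] []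
  rw [store_swap, store_swap false, Bool.not_false] at h2
  have h := (seq_assoc ((scan_scan x y m).seq (h1.seq h2))).mono
    (n := 7 * (x.size + y.size) + 6) (by simp; omega)
  simpa [Prog.swap] using h

theorem nip (x y : BTree) (m : List Bool) :
    Runs Prog.nip (onM (x.code ++ (y.code ++ m))) (7 * (x.size + y.size) + 6)
      (onM (x.code ++ m)) := by
  have h1 := clear false y.code.reverse m x.code.reverse []
  rw [store_swap, store_swap false, Bool.not_false] at h1
  have h2 := restore true x.code.reverse m [] []
  have h := (seq_assoc ((scan_scan x y m).seq (h1.seq h2))).mono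
    (n := 7 * (x.size + y.size) + 6) (by simp; omega)
  simpa [Prog.nip] using h

theorem pushAll : ∀ (l m : List Bool),
    Runs (Prog.pushAll l) (onM m) l.length (onM (l ++ m))
  | [], _ => Runs.skip _
  | b :: l, m => (pushAll l m).seq (Runs.pushM true b (l ++ m) [] [] [])

end Runs

/-! ### Comparison of two trees -/

namespace Prog

/-- Compare the auxiliary stacks from the top; the counter counts differences. -/
def compareBody (b : Bool) : Prog :=
  .pop (aux false) fun o => if o = some b then .skip else .push .N true

/-- Compare the auxiliary stacks, which are emptied, and push the result on the main stack. -/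
def compare : Prog :=
  .seq (.loop (aux true) compareBody) <| .seq (.loop (aux false) fun _ => .push .N true) <|
    .pop .N fun
      | none => pushAll (BTree.ofBool true).code
      | some _ => .seq (.loop .N fun _ => .skip) (pushAll (BTree.ofBool false).code)

/-- Replace a pair of trees by the truth value of their equality. -/
def eq : Prog :=
  .pop .M fun _ => .seq (.seq (scan true) (scan false)) compare

end Prog

namespace Runs

theorem compareBody (b : Bool) (m l o : List Bool) (n : ℕ) :
    Runs (Prog.compareBody b) (store true m l o (List.replicate n true)) 2
      (store true m l o.tail (List.replicate (n + if o.head? = some b then 0 else 1) true)) := by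
  rw [store_swap, store_swap true, Bool.not_true]
  refine Runs.popAux (t := 1) ?_
  by_cases h : o.head? = some b
  · simpa [h] using (Runs.skip _).mono zero_le_one
  · simpa [h, List.replicate_succ] using Runs.pushN false true m o.tail l (List.replicate n true)

/-- A mismatch, or a second stack that is too short, increases the counter; a second stack that is
too long leaves a remainder `o'`. The stacks agree exactly if neither occurs. -/
theorem loop_compareBody : ∀ (l o m : List Bool) (n : ℕ), ∃ n' ≤ n + l.length,
    ∃ o' : List Bool, o'.length ≤ o.length ∧ (n' + o'.length = 0 ↔ l = o ∧ n = 0) ∧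
    Runs (.loop (aux true) Prog.compareBody) (store true m l o (List.replicate n true))
      (3 * l.length + 1) (store true m [] o' (List.replicate n' true))
  | [], o, m, n => ⟨n, le_rfl, o, le_rfl, by
      cases o <;> simp, by simpa using Runs.loopAux_nil⟩
  | b :: l, o, m, n => by
    obtain ⟨n', hn', o', ho', he, h⟩ :=
      loop_compareBody l o.tail m (n + if o.head? = some b then 0 else 1)
    refine ⟨n', hn'.trans ?_, o', ho'.trans (by simp), he.trans ?_,
      (Runs.loopAux_cons (compareBody b m l o n) h).mono (by simp; omega)⟩
    · split_ifs <;> simp; omega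
    · cases o with
      | nil => simp
      | cons c o =>
        by_cases hc : c = b
        · simp [hc]
        · simp [hc, Ne.symm hc]

theorem loop_pushN (k : Bool) : ∀ (l m o : List Bool) (n : ℕ),
    Runs (.loop (aux k) fun _ => .push .N true) (store k m l o (List.replicate n true))
      (2 * l.length + 1) (store k m [] o (List.replicate (n + l.length) true))
  | [], _, _, _ => Runs.loopAux_nil
  | b :: l, m, o, n => by
    have h := loop_pushN k l m o (n + 1)
    rw [show n + 1 + l.length = n + (l.length + 1) by omega] at h
    exact (Runs.loopAux_cons (p := fun _ => .push .N true)
      (Runs.pushN k true m l o (List.replicate n true)) h).mono (by simp; omega)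

theorem clearN (k : Bool) : ∀ (n m l o : List Bool),
    Runs (.loop .N fun _ => .skip) (store k m l o n) (n.length + 1) (store k m l o [])
  | [], _, _, _ => Runs.loopN_nil
  | b :: n, m, l, o =>
    (Runs.loopN_cons (Runs.skip _) (clearN k n m l o)).mono (by simp)

theorem compare (l o m : List Bool) :
    Runs Prog.compare (store true m l o []) (4 * l.length + 3 * o.length + 7)
      (onM ((BTree.ofBool (l = o)).code ++ m)) := by
  obtain ⟨n, hn, o', ho', he, h⟩ := loop_compareBody l o m 0
  have h2 := loop_pushN false o' m [] n
  rw [store_swap, store_swap false, Bool.not_false] at h2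
  refine (h.seq (h2.seq (Runs.popN (t := n + o'.length + 4) ?_))).mono (by omega)
  by_cases hlo : l = o
  · have : n + o'.length = 0 := by rw [he]; simp [hlo]
    rw [this]
    simpa [hlo, BTree.ofBool, BTree.code] using
      (pushAll (BTree.ofBool true).code m).mono (n := 4) (by simp [BTree.ofBool, BTree.size])
  · obtain ⟨j, hj⟩ : ∃ j, n + o'.length = j + 1 :=
      Nat.exists_eq_succ_of_ne_zero (by rw [Ne, he]; simp [hlo])
    rw [hj]
    have h3 := clearN true (List.replicate j true) m [] []
    simpa [hlo, List.replicate_succ] using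
      (h3.seq (pushAll (BTree.ofBool false).code m)).mono (n := j + 1 + 4)
        (by simp [BTree.ofBool, BTree.size])

theorem eq (x y : BTree) (m : List Bool) :
    Runs Prog.eq (onM ((BTree.node x y).code ++ m)) (9 * (x.size + y.size) + 12)
      (onM ((BTree.ofBool (x = y)).code ++ m)) := by
  have h := (scan_scan x y m).seq (compare x.code.reverse y.code.reverse m)
  have e : (x.code.reverse = y.code.reverse) ↔ x = y := by
    rw [List.reverse_inj, BTree.code_injective.eq_iff]
  simp only [e] at h
  -- The pop removes the leading bit of the pair, which leaves the codes of its two components.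
  refine (Runs.popM ?_).mono (m := 9 * (x.size + y.size) + 11 + 1) (by omega)
  simpa [BTree.code] using h.mono (n := 9 * (x.size + y.size) + 11) (by simp; omega)

end Runs

end StackProg

/-! ### Families of trees that are computed in polynomial time -/

namespace StackProg

theorem polynomial_eval_mono (T : Polynomial ℕ) {m n : ℕ} (h : m ≤ n) : T.eval m ≤ T.eval n := by
  rw [Polynomial.eval_eq_sum, Polynomial.eval_eq_sum]
  exact Finset.sum_le_sum fun i _ => Nat.mul_le_mul_left _ (Nat.pow_le_pow_left h i)

/-- Some program replaces, for every `i`, the tree `x i` on top of the stack by the tree `y i`, in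
a number of steps that is polynomial in the size of `x i`. -/
def PolyMap {ι : Type} (x y : ι → BTree) : Prop :=
  ∃ (p : Prog) (T : Polynomial ℕ), ∀ i m,
    Runs p (Runs.onM ((x i).code ++ m)) (T.eval (x i).size) (Runs.onM ((y i).code ++ m))

namespace PolyMap

variable {ι κ : Type} {x y z : ι → BTree}

theorem size_le (h : PolyMap x y) :
    ∃ Q : Polynomial ℕ, ∀ i, (y i).size ≤ Q.eval (x i).size := by
  obtain ⟨p, T, h⟩ := h
  refine ⟨.X + T, fun i => ?_⟩
  have e (l : List Bool) : Store.size (Runs.onM l) = l.length := rfl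
  have h1 := (h i []).size_le
  rw [e, e] at h1
  simpa using h1

theorem reindex (h : PolyMap x y) (g : κ → ι) :
    PolyMap (fun j => x (g j)) (fun j => y (g j)) := by
  obtain ⟨p, T, h⟩ := h
  exact ⟨p, T, fun j m => h (g j) m⟩

theorem refl (x : ι → BTree) : PolyMap x x := ⟨.skip, 0, fun i m => by simpa using Runs.skip _⟩

theorem trans (h₁ : PolyMap x y) (h₂ : PolyMap y z) : PolyMap x z := by
  obtain ⟨Q, hQ⟩ := h₁.size_le
  obtain ⟨p₁, T₁, h₁⟩ := h₁
  obtain ⟨p₂, T₂, h₂⟩ := h₂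
  refine ⟨p₁.seq p₂, T₁ + T₂.comp Q, fun i m => ((h₁ i m).seq (h₂ i m)).mono ?_⟩
  simpa using polynomial_eval_mono T₂ (hQ i)

theorem const (x : ι → BTree) (t : BTree) : PolyMap x fun _ => t := by
  refine ⟨Prog.drop.seq (Prog.pushAll t.code), 6 * .X + (3 + t.size : ℕ), fun i m =>
    ((Runs.drop (x i) m).seq (Runs.pushAll t.code m)).mono ?_⟩
  simp; omega

/-- The right component is computed first, on a copy, so that the left one ends on top of it; a
leading `true` then makes the two codes the code of a node. -/
theorem node (h₁ : PolyMap x y) (h₂ : PolyMap x z) :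
    PolyMap x fun i => BTree.node (y i) (z i) := by
  obtain ⟨Q, hQ⟩ := h₂.size_le
  obtain ⟨p₁, T₁, h₁⟩ := h₁
  obtain ⟨p₂, T₂, h₂⟩ := h₂
  refine ⟨Prog.dup.seq (p₂.seq (Prog.swap.seq (p₁.seq (.push .M true)))),
    (12 * .X + 5) + (T₂ + ((7 * (Q + .X) + 6) + (T₁ + 1))), fun i m => ?_⟩
  have h := (Runs.dup (x i) m).seq <| (h₂ i ((x i).code ++ m)).seq <|
    (Runs.swap (z i) (x i) m).seq <| (h₁ i ((z i).code ++ m)).seq <|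
      Runs.pushM true true ((y i).code ++ ((z i).code ++ m)) [] [] []
  rw [BTree.code, List.cons_append, List.append_assoc]
  refine h.mono ?_
  have := hQ i
  simp; omega

theorem left (x : ι → BTree) : PolyMap x fun i => (x i).left := by
  refine ⟨.pop .M fun o => if o = some true then Prog.nip else .push .M false,
    7 * .X + 7, fun i m => ?_⟩
  simp only []
  generalize x i = x
  cases x with
  | nil =>
    refine Runs.mono (Runs.popM (t := 1) ?_) (m := 2) (by simp)
    simpa [BTree.code, BTree.left] using Runs.pushM true false m [] [] []
  | node l r =>
    refine Runs.mono (Runs.popM (t := 7 * (l.size + r.size) + 6) ?_) ?_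
    · simpa [BTree.code, BTree.left] using Runs.nip l r m
    · simp [BTree.size]; omega

theorem right (x : ι → BTree) : PolyMap x fun i => (x i).right := by
  refine ⟨.pop .M fun o => if o = some true then Prog.drop else .push .M false,
    6 * .X + 4, fun i m => ?_⟩
  simp only []
  generalize x i = x
  cases x with
  | nil =>
    refine Runs.mono (Runs.popM (t := 1) ?_) (m := 2) (by simp)
    simpa [BTree.code, BTree.right] using Runs.pushM true false m [] [] []
  | node l r =>
    refine Runs.mono (Runs.popM (t := 6 * l.size + 3) ?_) ?_
    · simpa [BTree.code, BTree.right] using Runs.drop l (r.code ++ m)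
    · simp [BTree.size]; omega

theorem eq (h₁ : PolyMap x y) (h₂ : PolyMap x z) :
    PolyMap x fun i => BTree.ofBool (y i = z i) := by
  refine (h₁.node h₂).trans ⟨Prog.eq, 9 * .X + 12, fun i m => (Runs.eq (y i) (z i) m).mono ?_⟩
  simp [BTree.size]

/-- Each branch has to work only on its own subfamily. This is a reason to consider indexed families
instead of functions on all trees. -/
theorem ite {b : ι → Bool} (hb : PolyMap x fun i => BTree.ofBool (b i))
    (h₁ : PolyMap (fun i : {i // b i = true} => x i) fun i => y i)
    (h₂ : PolyMap (fun i : {i // b i = false} => x i) fun i => y i) : PolyMap x y := by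
  obtain ⟨p, T, h⟩ := hb
  obtain ⟨p₁, T₁, h₁⟩ := h₁
  obtain ⟨p₂, T₂, h₂⟩ := h₂
  refine ⟨Prog.dup.seq (p.seq (.pop .M fun o => if o = some true then
    .pop .M fun _ => .pop .M fun _ => p₁ else p₂)),
    (12 * .X + 5) + (T + ((T₁ + T₂) + 3)), fun i m => ?_⟩
  have hd := (Runs.dup (x i) m).seq <| (h i ((x i).code ++ m)).seq <|
    Runs.popM (k := true) (m := (BTree.ofBool (b i)).code ++ ((x i).code ++ m)) (l := []) (o := [])
      (n := []) (t := (T₁.eval (x i).size + T₂.eval (x i).size) + 2)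
      (p := fun o => if o = some true then .pop .M fun _ => .pop .M fun _ => p₁ else p₂)
      (s := Runs.onM ((y i).code ++ m)) ?_
  · exact hd.mono (by simp)
  · cases hi : b i with
    | true =>
      -- The code of `ofBool true` has three bits; two remain after the test.
      simp only [BTree.ofBool, BTree.code, List.cons_append, List.head?_cons, if_true,
        List.tail_cons, List.nil_append]
      exact Runs.popM (Runs.popM ((h₁ ⟨i, hi⟩ m).mono (Nat.le_add_right _ _)))
    | false =>
      simp only [BTree.ofBool, BTree.code, List.cons_append, List.head?_cons,
        Option.some.injEq, Bool.false_eq_true, if_false, List.tail_cons, List.nil_append]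
      exact (h₂ ⟨i, hi⟩ m).mono (by dsimp only; omega)

/-- The body of a loop that is repeated as long as it yields a pair with left component
`ofBool true`. -/
def iterateBody (p : Prog) : Prog :=
  p.seq <| .pop .M fun _ => .pop .M fun o => if o = some true then
    .pop .M fun _ => .pop .M fun _ => .push .N true else .skip

theorem runs_iterateBody {p : Prog} {x y : BTree} {b : Bool} {t : ℕ} {m : List Bool}
    (h : Runs p (Runs.onM (x.code ++ m)) t
      (Runs.onM ((BTree.node (BTree.ofBool b) y).code ++ m))) :
    Runs (iterateBody p) (Runs.onM (x.code ++ m)) (t + 5)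
      (store true (y.code ++ m) [] [] (if b then [true] else [])) := by
  refine h.seq (Runs.popM (Runs.popM ?_))
  cases b with
  | true =>
    refine Runs.popM (Runs.popM ?_)
    simpa [BTree.code, BTree.ofBool] using Runs.pushN true true (y.code ++ m) [] [] []
  | false =>
    simpa [BTree.code, BTree.ofBool] using
      (Runs.skip (store true (y.code ++ m) [] [] [])).mono (Nat.zero_le 3)

/-- Bounded iteration. -/
theorem iterate {s : ι → ℕ → BTree} {N : ι → ℕ}
    (h : PolyMap (fun q : ι × ℕ => s q.1 q.2) fun q =>
      BTree.node (BTree.ofBool (q.2 < N q.1)) (s q.1 (q.2 + 1)))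
    (Q : Polynomial ℕ) (hN : ∀ i, N i ≤ Q.eval (s i 0).size)
    (hs : ∀ i j, (s i j).size ≤ Q.eval (s i 0).size) :
    PolyMap (fun i => s i 0) fun i => s i (N i + 1) := by
  obtain ⟨p, T, h⟩ := h
  refine ⟨.seq (.push .N true) (.loop .N fun _ => iterateBody p),
    1 + ((Q + 1) * (T.comp Q + 6) + 1), fun i m => ?_⟩
  -- One bit on the counter stands for one more round. The loop removes it before the body runs, so
  -- the body finds the counter empty and may use it. Here `d` is the number of rounds after the
  -- current one.
  have key : ∀ d j, j + d = N i →
      Runs (.loop .N fun _ => iterateBody p) (store true ((s i j).code ++ m) [] [] [true])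
        ((d + 1) * (T.eval (Q.eval (s i 0).size) + 6) + 1)
        (Runs.onM ((s i (N i + 1)).code ++ m)) := by
    intro d
    induction d with
    -- The round that reports the end still advances the state, hence `N i + 1`.
    | zero =>
      intro j hj
      obtain rfl : j = N i := hj
      have hb := runs_iterateBody (h (i, N i) m)
      simp only [lt_irrefl, decide_false, Bool.false_eq_true, if_false] at hb
      refine (Runs.loopN_cons hb Runs.loopN_nil).mono ?_
      have := polynomial_eval_mono T (hs i (N i))
      simp; omega
    | succ d ih =>
      intro j hj
      have hb := runs_iterateBody (h (i, j) m)
      have hlt : j < N i := by omega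
      simp only [hlt, decide_true, if_true] at hb
      refine (Runs.loopN_cons hb (ih (j + 1) (by omega))).mono ?_
      have := polynomial_eval_mono T (hs i j)
      rw [add_mul (d + 1) 1]
      omega
  refine ((Runs.pushN true true _ [] [] []).seq (key (N i) 0 (by omega))).mono ?_
  have := Nat.mul_le_mul_right (T.eval (Q.eval (s i 0).size) + 6)
    (Nat.add_le_add_right (hN i) 1)
  simpa using this

end PolyMap

/-! ### Polynomial-time functions on types that are coded by trees -/

/-- An injective coding of a type by trees. -/
class Code (α : Type) where
  /-- The code of an element. -/
  enc : α → BTree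
  enc_injective : Function.Injective enc

/-- The size of the code of an element. -/
abbrev Code.size {α : Type} [Code α] (a : α) : ℕ := (Code.enc a).size

open Code

instance : Code Bool := ⟨BTree.ofBool, by intro a b; cases a <;> cases b <;> simp [BTree.ofBool]⟩

instance {α β : Type} [Code α] [Code β] : Code (α × β) :=
  ⟨fun q => .node (enc q.1) (enc q.2), fun q q' h => by
    rw [BTree.node.injEq] at h
    exact Prod.ext (enc_injective h.1) (enc_injective h.2)⟩

/-- The code of a list. -/
def encList {α : Type} [Code α] : List α → BTree
  | [] => .nil
  | a :: l => .node (enc a) (encList l)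

theorem encList_injective {α : Type} [Code α] : ∀ l m : List α, encList l = encList m → l = m
  | [], [], _ => rfl
  | [], _ :: _, h => by simp [encList] at h
  | _ :: _, [], h => by simp [encList] at h
  | a :: l, b :: m, h => by
    simp only [encList, BTree.node.injEq] at h
    rw [enc_injective h.1, encList_injective l m h.2]

instance {α : Type} [Code α] : Code (List α) := ⟨encList, encList_injective⟩

/-! ### Sizes of codes -/

section size

variable {α β : Type} [Code α] [Code β]

theorem size_pair (a : α) (b : β) : size (a, b) = size a + size b + 1 := rfl

@[simp] theorem size_nil : size ([] : List α) = 1 := rfl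

@[simp] theorem size_cons (a : α) (l : List α) : size (a :: l) = size a + size l + 1 := rfl

theorem size_bool_le (b : Bool) : size b ≤ 3 := by cases b <;> decide

theorem size_append (l m : List α) : size (l ++ m) + 1 = size l + size m := by
  induction l with
  | nil => simp; omega
  | cons a l ih => simp; omega

theorem size_reverse (l : List α) : size l.reverse = size l := by
  induction l with
  | nil => rfl
  | cons a l ih => have := size_append l.reverse [a]; simp at this ⊢; omega

theorem size_le_of_sublist {l m : List α} (h : l.Sublist m) : size l ≤ size m := by
  induction h with
  | slnil => exact le_rfl
  | cons a _ ih => simp; omega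
  | cons_cons a _ ih => simp; omega

theorem length_lt_size (l : List α) : l.length < size l := by
  induction l with
  | nil => simp
  | cons a l ih => simp; omega

theorem size_le_of_mem {a : α} {l : List α} (h : a ∈ l) : size a ≤ size l := by
  have := size_le_of_sublist (List.singleton_sublist.2 h)
  simp at this; omega

end size

theorem size_flatMap_le {α β : Type} [Code β] {l : List α} {g : α → List β} {K : ℕ}
    (h : ∀ a ∈ l, size (g a) ≤ K) :
    size (l.flatMap g) ≤ 1 + l.length * K := by
  induction l with
  | nil => simp
  | cons a l ih =>
    have h1 := ih fun a ha => h a (by simp [ha])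
    have h2 := h a (by simp)
    have h3 := size_append (g a) (l.flatMap g)
    rw [List.flatMap_cons, List.length_cons, add_mul]
    omega

/-- Polynomial-time functions. -/
def PolyFun {γ α : Type} [Code γ] [Code α] (f : γ → α) : Prop :=
  PolyMap (fun c => enc c) fun c => enc (f c)

namespace PolyFun

/-- The state of a left fold before its step `j`. -/
def foldState {γ α β : Type} (l : γ → List α) (init : γ → β) (h : γ → β → α → β) (c : γ) (j : ℕ) :
    List α × β × γ :=
  ((l c).drop j, ((l c).take j).foldl (h c) (init c), c)

/-- One step of a left fold, together with the information whether there was anything to do. -/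
def foldStep {γ α β : Type} (h : γ → β → α → β) (q : List α × β × γ) : Bool × List α × β × γ :=
  match q.1 with
  | [] => (false, q)
  | a :: t => (true, t, h q.2.2 q.2.1 a, q.2.2)

/-- Past the end of the list `drop` and `take` are constant, so the additional round made by
`PolyMap.iterate` is harmless. -/
theorem foldStep_foldState {γ α β : Type} (l : γ → List α) (init : γ → β) (h : γ → β → α → β)
    (c : γ) (j : ℕ) :
    foldStep h (foldState l init h c j)
      = (decide (j < (l c).length), foldState l init h c (j + 1)) := by
  unfold foldState
  by_cases hj : j < (l c).length
  · rw [List.drop_eq_getElem_cons hj]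
    simp [hj, foldStep, ← List.take_concat_get', List.foldl_append, -List.take_append_getElem]
  · rw [List.drop_of_length_le (by omega : (l c).length ≤ j),
      List.drop_of_length_le (by omega : (l c).length ≤ j + 1),
      List.take_of_length_le (by omega : (l c).length ≤ j),
      List.take_of_length_le (by omega : (l c).length ≤ j + 1)]
    simp [hj, foldStep]

variable {γ α β : Type} [Code γ] [Code α] [Code β]

theorem id : PolyFun fun c : γ => c := PolyMap.refl _

theorem const (a : α) : PolyFun fun _ : γ => a := PolyMap.const _ _

theorem comp {f : α → β} {g : γ → α} (hf : PolyFun f) (hg : PolyFun g) :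
    PolyFun fun c => f (g c) := PolyMap.trans hg (PolyMap.reindex hf g)

theorem pair {f : γ → α} {g : γ → β} (hf : PolyFun f) (hg : PolyFun g) :
    PolyFun fun c => (f c, g c) := PolyMap.node hf hg

theorem fst {f : γ → α × β} (hf : PolyFun f) : PolyFun fun c => (f c).1 :=
  PolyMap.trans hf (PolyMap.left _)

theorem snd {f : γ → α × β} (hf : PolyFun f) : PolyFun fun c => (f c).2 :=
  PolyMap.trans hf (PolyMap.right _)

theorem cons {f : γ → α} {g : γ → List α} (hf : PolyFun f) (hg : PolyFun g) :
    PolyFun fun c => f c :: g c := PolyMap.node hf hg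

theorem decide_eq [DecidableEq α] {f g : γ → α} (hf : PolyFun f) (hg : PolyFun g) :
    PolyFun fun c => decide (f c = g c) := by
  have h := PolyMap.eq hf hg
  simp only [enc_injective.eq_iff] at h
  exact h

theorem ite {b : γ → Bool} {f g : γ → α} (hb : PolyFun b) (hf : PolyFun f) (hg : PolyFun g) :
    PolyFun fun c => if b c then f c else g c := by
  refine PolyMap.ite (b := b) hb ?_ ?_
  · have h : (fun i : {i // b i = true} => enc (if b i then f i else g i))
        = fun i => enc (f i.1) := funext fun i => by simp [i.2]
    rw [h]
    exact PolyMap.reindex hf Subtype.val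
  · have h : (fun i : {i // b i = false} => enc (if b i then f i else g i))
        = fun i => enc (g i.1) := funext fun i => by simp [i.2]
    rw [h]
    exact PolyMap.reindex hg Subtype.val

theorem not {b : γ → Bool} (hb : PolyFun b) : PolyFun fun c => !b c := by
  simpa [Bool.not_eq_true'] using ite hb (const false) (const true)

theorem and {b b' : γ → Bool} (hb : PolyFun b) (hb' : PolyFun b') :
    PolyFun fun c => b c && b' c := by
  convert ite hb hb' (const false) using 2 with c
  cases b c <;> rfl

theorem or {b b' : γ → Bool} (hb : PolyFun b) (hb' : PolyFun b') :
    PolyFun fun c => b c || b' c := by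
  convert ite hb (const true) hb' using 2 with c
  cases b c <;> rfl

/-- Case distinction on a list. -/
theorem listCases {l : γ → List α} {f g : γ → β} {h : γ → α → List α → β} (hl : PolyFun l)
    (hg : PolyFun g) (hh : PolyFun fun q : γ × α × List α => h q.1 q.2.1 q.2.2)
    (hf_nil : ∀ c, l c = [] → f c = g c) (hf_cons : ∀ c a t, l c = a :: t → f c = h c a t) :
    PolyFun f := by
  classical
  refine PolyMap.ite (b := fun c => decide (l c = [])) (decide_eq hl (const [])) ?_ ?_
  · convert PolyMap.reindex hg (Subtype.val (p := fun c => decide (l c = []) = true))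
      using 2 with i
    rw [hf_nil i.1 (by simpa using i.2)]
  · have key : ∀ i : {c // decide (l c = []) = false}, ∃ q : α × List α, l i.1 = q.1 :: q.2 := by
      intro i
      have hi : l i.1 ≠ [] := by simpa using i.2
      obtain ⟨a, t, h⟩ := List.exists_cons_of_ne_nil hi
      exact ⟨(a, t), h⟩
    choose q hq using key
    have h1 := PolyMap.reindex (PolyMap.node (PolyMap.refl _) hl)
      (Subtype.val (p := fun c => decide (l c = []) = false))
    have h2 := PolyMap.reindex hh fun i : {c // decide (l c = []) = false} => (i.1, q i)
    -- A nonempty list has the same code as the pair of its head and its tail, so splitting it costs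
    -- nothing.
    have e1 : (fun i : {c // decide (l c = []) = false} => BTree.node (enc i.1) (enc (l i.1)))
        = fun i => enc (i.1, q i) := by
      funext i
      rw [hq i]
      rfl
    rw [e1] at h1
    convert PolyMap.trans h1 h2 using 2 with i
    rw [hf_cons i.1 _ _ (hq i)]

theorem size_le {f : γ → α} (hf : PolyFun f) :
    ∃ Q : Polynomial ℕ, ∀ c, size (f c) ≤ Q.eval (size c) := PolyMap.size_le hf

theorem foldStep_polyFun {h : γ → β → α → β}
    (hh : PolyFun fun q : γ × β × α => h q.1 q.2.1 q.2.2) : PolyFun (foldStep h) := by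
  have h1 : PolyFun fun q : (List α × β × γ) × α × List α =>
      h q.1.2.2 q.1.2.1 q.2.1 :=
    comp (f := fun q : γ × β × α => h q.1 q.2.1 q.2.2) hh
      (id.fst.snd.snd.pair (id.fst.snd.fst.pair id.snd.fst))
  exact listCases id.fst ((const false).pair id)
    ((const true).pair (id.snd.snd.pair (h1.pair id.fst.snd.snd)))
    (fun q hq => by rw [foldStep, hq]) (fun q a t hq => by rw [foldStep, hq])

/-- Recursion on a list, provided that the size of the intermediate results is bounded. -/
theorem foldl {l : γ → List α} {init : γ → β} {h : γ → β → α → β} (hl : PolyFun l)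
    (hi : PolyFun init) (hh : PolyFun fun q : γ × β × α => h q.1 q.2.1 q.2.2) (Q : Polynomial ℕ)
    (hQ : ∀ c k, size (((l c).take k).foldl (h c) (init c)) ≤ Q.eval (size c)) :
    PolyFun fun c => (l c).foldl (h c) (init c) := by
  obtain ⟨Ql, hQl⟩ := hl.size_le
  have e (c j) : size (foldState l init h c j) = size ((l c).drop j)
      + (size (((l c).take j).foldl (h c) (init c)) + size c + 1) + 1 := rfl
  -- The state carries `c` along, so bounds in the size of `c` become bounds in the size of the
  -- initial state.
  have hc (c) : size c ≤ size (foldState l init h c 0) := by rw [e]; omega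
  have hsize (c j) : size (foldState l init h c j)
      ≤ (Ql + Q + .X + 2).eval (size (foldState l init h c 0)) := by
    have h1 : size ((l c).drop j) ≤ size (l c) := size_le_of_sublist (List.drop_sublist _ _)
    have h2 := hc c
    have h3 := (hQl c).trans (polynomial_eval_mono Ql h2)
    have h4 := (hQ c j).trans (polynomial_eval_mono Q h2)
    rw [e c j]
    simp only [Polynomial.eval_add, Polynomial.eval_X, Polynomial.eval_ofNat]
    omega
  have hlen (c) : (l c).length
      ≤ (Ql + Q + .X + 2).eval (size (foldState l init h c 0)) := by
    have h3 := (hQl c).trans (polynomial_eval_mono Ql (hc c))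
    have h4 := length_lt_size (l c)
    simp only [Polynomial.eval_add]
    omega
  have hstep := PolyMap.reindex (foldStep_polyFun hh)
    fun q : γ × ℕ => foldState l init h q.1 q.2
  simp only [foldStep_foldState] at hstep
  have hit := PolyMap.iterate (s := fun c j => enc (foldState l init h c j))
    (N := fun c => (l c).length) hstep _ hlen hsize
  have h0 : PolyFun fun c => foldState l init h c 0 := hl.pair (hi.pair id)
  have h1 : PolyFun fun c => foldState l init h c ((l c).length + 1) := PolyMap.trans h0 hit
  have h2 := h1.snd.fst
  have e2 : ∀ c, (foldState l init h c ((l c).length + 1)).2.1 = (l c).foldl (h c) (init c) :=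
    fun c => by rw [foldState, List.take_of_length_le (Nat.le_succ _)]
  simpa only [e2] using h2

/-- A fold that conses one element per step. Applied twice it gives `append`. -/
theorem reverse_append {f g : γ → List α} (hf : PolyFun f) (hg : PolyFun g) :
    PolyFun fun c => (f c).reverse ++ g c := by
  obtain ⟨Qf, hQf⟩ := hf.size_le
  obtain ⟨Qg, hQg⟩ := hg.size_le
  have e : ∀ l m : List α, l.foldl (fun acc a => a :: acc) m = l.reverse ++ m := by
    intro l
    induction l with
    | nil => simp
    | cons a l ih => simp [ih]
  have h := foldl hf hg (h := fun _ acc a => a :: acc) (id.snd.snd.cons id.snd.fst) (Qf + Qg)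
    fun c k => by
      have h1 := size_append ((f c).take k).reverse (g c)
      have h2 : size ((f c).take k) ≤ size (f c) := size_le_of_sublist (List.take_sublist _ _)
      rw [size_reverse] at h1
      rw [e, Polynomial.eval_add]
      have := hQf c
      have := hQg c
      omega
  simpa only [e] using h

theorem reverse {f : γ → List α} (hf : PolyFun f) : PolyFun fun c => (f c).reverse := by
  simpa using reverse_append hf (const [])

theorem append {f g : γ → List α} (hf : PolyFun f) (hg : PolyFun g) :
    PolyFun fun c => f c ++ g c := by
  simpa using reverse_append hf.reverse hg

theorem flatMap {l : γ → List α} {g : γ → α → List β} (hl : PolyFun l)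
    (hg : PolyFun fun q : γ × α => g q.1 q.2) : PolyFun fun c => (l c).flatMap (g c) := by
  obtain ⟨Ql, hQl⟩ := hl.size_le
  obtain ⟨Qg, hQg⟩ := hg.size_le
  have e : ∀ c (l : List α) (m : List β),
      l.foldl (fun acc a => acc ++ g c a) m = m ++ l.flatMap (g c) := by
    intro c l
    induction l with
    | nil => simp
    | cons a l ih => simp [ih]
  have h := foldl hl (const []) (h := fun c acc a => acc ++ g c a)
    (append id.snd.fst (hg.comp (id.fst.pair id.snd.snd)))
    -- At most `Ql` blocks, each computed from a pair `(c, a)` of size at most `size c + Ql + 1`.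
    (1 + Ql * Qg.comp (.X + Ql + 1)) fun c k => by
      rw [e, List.nil_append]
      refine (size_flatMap_le (K := Qg.eval (size c + Ql.eval (size c) + 1)) fun a ha => ?_).trans ?_
      · refine (hQg (c, a)).trans (polynomial_eval_mono Qg ?_)
        have h1 := size_le_of_mem (List.mem_of_mem_take ha)
        have h2 := hQl c
        rw [size_pair]
        omega
      · have h1 : ((l c).take k).length ≤ Ql.eval (size c) :=
          ((List.length_take_le' _ _).trans (length_lt_size _).le).trans (hQl c)
        simpa using Nat.mul_le_mul_right _ h1
  simpa only [e, List.nil_append] using h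

theorem map {l : γ → List α} {g : γ → α → β} (hl : PolyFun l)
    (hg : PolyFun fun q : γ × α => g q.1 q.2) : PolyFun fun c => (l c).map (g c) := by
  have h := flatMap hl (g := fun c a => [g c a]) (hg.cons (const []))
  have e : ∀ c (l : List α), l.flatMap (fun a => [g c a]) = l.map (g c) := by
    intro c l
    induction l with
    | nil => rfl
    | cons a l ih => simp [ih]
  simpa only [e] using h

theorem filter {l : γ → List α} {p : γ → α → Bool} (hl : PolyFun l)
    (hp : PolyFun fun q : γ × α => p q.1 q.2) : PolyFun fun c => (l c).filter (p c) := by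
  have h := flatMap hl (g := fun c a => if p c a then [a] else [])
    (hp.ite (id.snd.cons (const [])) (const []))
  have e : ∀ c (l : List α), l.flatMap (fun a => if p c a then [a] else []) = l.filter (p c) := by
    intro c l
    induction l with
    | nil => rfl
    | cons a l ih => cases h : p c a <;> simp [ih, h]
  simpa only [e] using h

theorem any {l : γ → List α} {p : γ → α → Bool} (hl : PolyFun l)
    (hp : PolyFun fun q : γ × α => p q.1 q.2) : PolyFun fun c => (l c).any (p c) := by
  classical
  have h := not (decide_eq (filter hl hp) (const []))
  convert h using 2 with c
  rw [Bool.eq_iff_iff]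
  simp

end PolyFun

end StackProg

/-! ### From polynomial-time functions to Turing machines -/

namespace StackProg

/-- Push a list of bits on the main stack, as a part of one machine step. -/
def pushStmt {Γ L : Type} : List Bool → TM2.Stmt (StackType Γ) L (State Γ) →
    TM2.Stmt (StackType Γ) L (State Γ)
  | [], q => q
  | b :: l, q => pushStmt l (.push (some .M) (fun _ => b) q)

theorem stepAux_pushStmt {Γ L : Type} (w : List Γ) (v : State Γ) : ∀ (l m : List Bool)
    (q : TM2.Stmt (StackType Γ) L (State Γ)),
    TM2.stepAux (pushStmt l q) v (contents w (Runs.onM m))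
      = TM2.stepAux q v (contents w (Runs.onM (l ++ m)))
  | [], _, _ => rfl
  | b :: l, m, q => by
    rw [pushStmt, stepAux_pushStmt w v l m]
    refine congrArg (TM2.stepAux q v) ((update_contents w _ .M (b :: (l ++ m))).trans ?_)
    rw [update_store_M]
    rfl

section machine

variable (Γ : Type) (p : Prog)

/-- The control points of the machine that decides a language: beginning, reading of the input,
end, writing of the code of an input symbol, and execution of the program. -/
abbrev MachineLabel : Type := Option (Option (Option (Γ ⊕ p.Label)))

variable {Γ}

/-- The code of the machine that decides a language. -/
def machineCode [Code Γ] : MachineLabel Γ p → TM2.Stmt (StackType Γ) (MachineLabel Γ p) (State Γ)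
  | none => .push (some .M) (fun _ => false) (.goto fun _ => some none)
  | some none => .pop none (fun _ r => Option.map Sum.inr r) (.goto fun v =>
      match v.bind Sum.getRight? with
      | none => p.start (fun l => some (some (some (.inr l)))) (some (some none))
      | some a => some (some (some (.inl a))))
  | some (some none) => .pop (some .M) (fun _ r => Option.map Sum.inl r)
      (.branch (fun v => v.bind Sum.getLeft? == some true)
        (.pop (some .M) (fun v _ => v) (.pop (some .M) (fun v _ => v)
          (.push (some .M) (fun _ => true) (.load (fun _ => none) .halt))))
        (.push (some .M) (fun _ => false) (.load (fun _ => none) .halt)))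
  | some (some (some (.inl a))) => pushStmt (true :: (Code.enc a).code) (.goto fun _ => some none)
  | some (some (some (.inr l))) =>
      p.code (fun l => some (some (some (.inr l)))) (some (some none)) l

/-- The machine that decides a language. -/
noncomputable def machine [Code Γ] [Fintype Γ] : FinTM2 :=
  letI : Fintype (StackType Γ none) := inferInstanceAs (Fintype Γ)
  { K := Option Stk
    k₀ := none
    k₁ := some .M
    Γ := StackType Γ
    Λ := MachineLabel Γ p
    main := none
    σ := State Γ
    initialState := none
    m := machineCode p }

variable [Code Γ]

/-- Pushing the code of `a` and then a bit `true` turns the code of `u` into the code of `a :: u`;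
the input thus arrives reversed. Each symbol takes two steps, and one step detects the end. -/
theorem reachesIn_read : ∀ w u : List Γ, ∀ v : State Γ, ∃ v',
    ReachesIn (machineCode p) ⟨some (some none), v, contents w (Runs.onM (Code.enc u).code)⟩
      ⟨some (p.start (fun l => some (some (some (.inr l)))) (some (some none))), v',
        contents [] (Runs.onM (Code.enc (w.reverse ++ u)).code)⟩ (2 * w.length + 1)
  | [], u, v => ⟨none, ReachesIn.step (congrArg (TM2.Cfg.mk _ _) (update_contents_none ..))⟩
  | a :: w, u, v => by
    obtain ⟨v', h⟩ := reachesIn_read w (a :: u) (some (.inr a))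
    have h1 : ReachesIn (machineCode p)
        ⟨some (some none), v, contents (a :: w) (Runs.onM (Code.enc u).code)⟩
        ⟨some (some (some (some (.inl a)))), some (.inr a),
          contents w (Runs.onM (Code.enc u).code)⟩ 1 :=
      ReachesIn.step (congrArg (TM2.Cfg.mk _ _) (update_contents_none ..))
    have h2 : ReachesIn (machineCode p)
        ⟨some (some (some (some (.inl a)))), some (.inr a),
          contents w (Runs.onM (Code.enc u).code)⟩
        ⟨some (some none), some (.inr a), contents w (Runs.onM (Code.enc (a :: u)).code)⟩ 1 :=
      ReachesIn.step (stepAux_pushStmt w _ _ _ _)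
    refine ⟨v', ?_⟩
    simpa using ((h1.trans h2).trans h).mono (n' := 2 * (w.length + 1) + 1) (by omega)

theorem reachesIn_end (b : Bool) (v : State Γ) :
    ReachesIn (machineCode p) ⟨some (some (some none)), v, contents [] (Runs.onM (Code.enc b).code)⟩
      ⟨none, none, contents [] (Runs.onM [b])⟩ 1 := by
  refine ReachesIn.step ?_
  have hu (m x : List Bool) : Function.update (contents ([] : List Γ) (Runs.onM m)) (some .M) x
      = contents [] (Runs.onM x) := (update_contents _ _ _ _).trans (by rw [update_store_M])
  cases b with
  | true =>
    refine congrArg (TM2.Cfg.mk none none) ?_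
    refine Eq.trans (congrArg (fun S => Function.update (Function.update (Function.update S
      (some .M) [false]) (some .M) []) (some .M) [true]) (hu _ [false, false])) ?_
    exact Eq.trans (congrArg (fun S => Function.update (Function.update S
      (some .M) []) (some .M) [true]) (hu _ _)) (Eq.trans (congrArg (fun S => Function.update S
      (some .M) [true]) (hu _ _)) (hu _ _))
  | false =>
    refine congrArg (TM2.Cfg.mk none none) ?_
    exact Eq.trans (congrArg (fun S => Function.update S (some .M) [false]) (hu _ [])) (hu _ _)

end machine

/-- A language is in P if its reversal is recognized by a polynomial-time function. -/
theorem inPTime_of_polyFun {Γ : Type} [Fintype Γ] [Code Γ] {F : List Γ → Bool} (hF : PolyFun F)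
    {L : Language Γ} (hL : ∀ w, F w.reverse = true ↔ w ∈ L) : InPTime L := by
  obtain ⟨p, T, h⟩ := hF
  -- A crude bound, uniform over the finite alphabet, for the share of one symbol in the size of a
  -- word.
  let K := ∑ a : Γ, (Code.size a + 1)
  have hK : ∀ w : List Γ, Code.size w ≤ 1 + K * w.length := by
    intro w
    induction w with
    | nil => simp
    | cons a w ih =>
      have : Code.size a + 1 ≤ K :=
        Finset.single_le_sum (f := fun a : Γ => Code.size a + 1) (fun _ _ => Nat.zero_le _)
          (Finset.mem_univ a)
      rw [size_cons, List.length_cons, mul_add]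
      omega
  refine ⟨fun w => F w.reverse, hL, ⟨⟨⟨machine p, Equiv.refl _, Equiv.refl _⟩,
    3 + 2 * .X + T.comp (1 + (K : ℕ) * .X), fun w => Nonempty.some ?_⟩⟩⟩
  have h0 : ReachesIn (machineCode p) ⟨some none, none, contents w (Runs.onM [])⟩
      ⟨some (some none), none, contents w (Runs.onM (Code.enc ([] : List Γ)).code)⟩ 1 :=
    ReachesIn.step (congrArg (TM2.Cfg.mk _ _) ((update_contents w _ .M [false]).trans
      (by rw [update_store_M]; rfl)))
  obtain ⟨v₁, h1⟩ := reachesIn_read p w [] none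
  have h2 := h (w.reverse ++ []) []
  simp only [List.append_nil] at h2
  rw [List.append_nil] at h1
  obtain ⟨v₂, h3⟩ := h2.reachesIn (m := machineCode p) ([] : List Γ)
    (fun l => some (some (some (.inr l)))) (some (some none)) (fun _ => rfl) v₁
  have h4 := reachesIn_end p (F w.reverse) v₂
  have h5 := (((h0.trans h1).trans h3).trans h4).mono
    (n' := (3 + 2 * .X + T.comp (1 + (K : Polynomial ℕ) * .X)).eval w.length) (by
      have h6 := polynomial_eval_mono T (hK w.reverse)
      rw [List.length_reverse] at h6
      simp only [Polynomial.eval_add, Polynomial.eval_mul, Polynomial.eval_X,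
        Polynomial.eval_comp, Polynomial.eval_one, Polynomial.eval_natCast,
        Polynomial.eval_ofNat]
      simp only [Code.size, Nat.cast_id] at h6 ⊢
      omega)
  have e1 : initList (machine (Γ := Γ) p) (List.map (Equiv.refl Γ).invFun w)
      = (⟨some none, none, contents w (Runs.onM [])⟩ :
        TM2.Cfg (StackType Γ) (MachineLabel Γ p) (State Γ)) := by
    refine congrArg (TM2.Cfg.mk (some none) none) (funext fun k => ?_)
    match k with
    | none => exact List.map_id w
    | some .M => rfl
    | some .B => rfl
    | some .C => rfl
    | some .N => rfl
  have e2 : haltList (machine (Γ := Γ) p)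
      (List.map (Equiv.refl Bool).invFun (Computability.encodeBool (F w.reverse)))
      = (⟨none, none, contents [] (Runs.onM [F w.reverse])⟩ :
        TM2.Cfg (StackType Γ) (MachineLabel Γ p) (State Γ)) := by
    refine congrArg (TM2.Cfg.mk none none) (funext fun k => ?_)
    match k with
    | none => rfl
    | some .M => rfl
    | some .B => rfl
    | some .C => rfl
    | some .N => rfl
  obtain ⟨h5⟩ := h5
  refine ⟨⟨⟨h5.steps, ?_⟩, h5.steps_le_m⟩⟩
  refine Eq.trans ?_ (h5.evals_in_steps.trans (congrArg some e2.symm))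
  exact congrArg (fun c => (flip bind (TM2.step (machineCode p)))^[h5.steps] (some c)) e1

end StackProg

/-! ### The algorithm -/

namespace PINC

open Computability

/-- Names of variables and of the two truth values. -/
abbrev Name : Type := List Bool

/-- The name of the truth value true. -/
def nameTrue : Name := [false]

/-- The name of the truth value false. -/
def nameFalse : Name := [false, false]

/-- The value of a name under an assignment of the variables. -/
def value (t : ℕ → Bool) (w : Name) : Bool :=
  if w = nameTrue then true else if w = nameFalse then false else t (decodeNat w)

/-- An inclusion atom between tuples of variables and truth values, as a list of pairs. -/
abbrev Atom : Type := List (Name × Name)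

/-- The atom with the given pairs; we always add that the truth values are preserved. -/
def mkAtom (l : Atom) : Atom := (nameTrue, nameTrue) :: (nameFalse, nameFalse) :: l

/-- The atoms of a formula without split-junctions. -/
def atoms : PINC → List Atom
  | .top => []
  | .bot => [mkAtom [(nameFalse, nameTrue)]]
  | .pos x => [mkAtom [(encodeNat x, nameTrue)]]
  | .neg x => [mkAtom [(encodeNat x, nameFalse)]]
  | .and φ ψ => atoms φ ++ atoms ψ
  | .or _ _ => []
  | .inc x y => [mkAtom (List.ofFn fun i => (encodeNat (x i), encodeNat (y i)))]

/-! ### Binary words that are indices of variables -/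

/-- The last digit of a number in binary is not zero. -/
def Canonical (w : Name) : Prop := w.getLast? ≠ some false

theorem canonical_encodePosNum (n : PosNum) : Canonical (encodePosNum n) := by
  induction n with
  | one => simp [encodePosNum, Canonical]
  | bit1 n ih | bit0 n ih =>
    obtain ⟨a, l, h⟩ := List.exists_cons_of_ne_nil (encodePosNum_nonempty n)
    rw [Canonical, h] at ih
    rw [Canonical, encodePosNum, h, List.getLast?_cons_cons]
    exact ih

theorem exists_encodePosNum {w : Name} (hw : Canonical w) (hne : w ≠ []) :
    ∃ n, encodePosNum n = w := by
  induction w with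
  | nil => exact absurd rfl hne
  | cons b w ih =>
    cases w with
    | nil =>
      have hb : b = true := by simpa [Canonical] using hw
      exact ⟨.one, by rw [hb]; rfl⟩
    | cons c w =>
      rw [Canonical, List.getLast?_cons_cons] at hw
      obtain ⟨n, hn⟩ := ih hw (by simp)
      cases b with
      | true => exact ⟨.bit1 n, by rw [encodePosNum, hn]⟩
      | false => exact ⟨.bit0 n, by rw [encodePosNum, hn]⟩

/-- This makes being an index of a variable a condition that the parser can check bit by bit. -/
theorem canonical_iff (w : Name) : Canonical w ↔ ∃ n, encodeNat n = w := by
  constructor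
  · intro h
    by_cases hw : w = []
    · exact ⟨0, hw ▸ rfl⟩
    · obtain ⟨n, hn⟩ := exists_encodePosNum h hw
      exact ⟨((Num.pos n : Num) : ℕ), by rw [encodeNat, Num.of_to_nat]; exact hn⟩
  · rintro ⟨n, rfl⟩
    unfold encodeNat
    cases (n : Num) with
    | zero => simp [encodeNum, Canonical]
    | pos n => exact canonical_encodePosNum n

theorem canonical_encodeNat (n : ℕ) : Canonical (encodeNat n) := (canonical_iff _).2 ⟨n, rfl⟩

@[simp]
theorem value_nameTrue (t : ℕ → Bool) : value t nameTrue = true := by simp [value]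

@[simp]
theorem value_nameFalse (t : ℕ → Bool) : value t nameFalse = false := by
  simp [value, nameTrue, nameFalse]

/-- The names of the truth values end in a zero digit, so they cannot clash with variables. -/
theorem encodeNat_ne (n : ℕ) : encodeNat n ≠ nameTrue ∧ encodeNat n ≠ nameFalse := by
  have h := canonical_encodeNat n
  constructor <;> intro e <;> simp [e, Canonical, nameTrue, nameFalse] at h

@[simp]
theorem value_encodeNat (t : ℕ → Bool) (n : ℕ) : value t (encodeNat n) = t n := by
  simp [value, encodeNat_ne]

/-! ### Reduction of formulas to inclusion atoms with truth values -/

/-- Team semantics of atoms. -/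
def AtomSat (T : Team) (A : Atom) : Prop :=
  ∀ t ∈ T, ∃ t' ∈ T, ∀ e ∈ A, value t e.1 = value t' e.2

theorem atomSat_mkAtom {T : Team} {l : Atom} : AtomSat T (mkAtom l) ↔
    ∀ t ∈ T, ∃ t' ∈ T, ∀ e ∈ l, value t e.1 = value t' e.2 := by
  simp only [AtomSat, mkAtom, List.forall_mem_cons, value_nameTrue, value_nameFalse, true_and]

/-- For a literal the right entry is a truth value, so the choice of `t'` is irrelevant and `t' = t`
will do. For `bot` the pair of 0 and 1 admits no `t'` at all, so the team must be empty. -/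
theorem sat_iff_atomSat (T : Team) : ∀ φ : PINC, φ.splits = 0 →
    (Sat T φ ↔ ∀ A ∈ φ.atoms, AtomSat T A)
  | .top, _ => by simp [Sat, atoms]
  | .bot, _ => by
    simp only [Sat, atoms, List.forall_mem_singleton, atomSat_mkAtom, value_nameTrue,
      value_nameFalse, Set.eq_empty_iff_forall_notMem]
    exact ⟨fun h t ht => absurd ht (h t), fun h t ht => by simpa using (h t ht).choose_spec.2⟩
  | .pos x, _ => by
    simp only [Sat, atoms, List.forall_mem_singleton, atomSat_mkAtom, value_nameTrue,
      value_encodeNat]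
    exact ⟨fun h t ht => ⟨t, ht, h t ht⟩, fun h t ht => (h t ht).choose_spec.2⟩
  | .neg x, _ => by
    simp only [Sat, atoms, List.forall_mem_singleton, atomSat_mkAtom, value_nameFalse,
      value_encodeNat]
    exact ⟨fun h t ht => ⟨t, ht, h t ht⟩, fun h t ht => (h t ht).choose_spec.2⟩
  | .and φ ψ, h => by
    simp only [splits, Nat.add_eq_zero_iff] at h
    simp only [Sat, atoms, List.mem_append, or_imp, forall_and, sat_iff_atomSat T φ h.1,
      sat_iff_atomSat T ψ h.2]
  | .or φ ψ, h => by simp [splits] at h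
  | .inc x y, _ => by
    simp only [Sat, atoms, List.forall_mem_singleton, atomSat_mkAtom, List.forall_mem_ofFn_iff,
      value_encodeNat]

/-! ### Equalities forced by the atoms -/

/-- The names that occur in a list of atoms, and the names of the truth values. -/
def names (d : List Atom) : List Name :=
  nameTrue :: nameFalse :: d.flatMap fun A => A.flatMap fun e => [e.1, e.2]

/-- All pairs of names. -/
def namePairs (d : List Atom) : List (Name × Name) :=
  (names d).flatMap fun u => (names d).map fun v => (u, v)

/-- Whether an equality follows in one step from the atoms and the equalities in `R`. -/
def derivable (d : List Atom) (R : List (Name × Name)) (q : Name × Name) : Bool :=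
  decide (q.1 = q.2) || ((R.any fun r => R.any fun r' =>
    decide (r.1 = r'.1) && (decide (r.2 = q.1) && decide (r'.2 = q.2))) ||
  d.any fun A => A.any fun e => A.any fun e' => decide (e.1 = q.1) && (decide (e'.1 = q.2) &&
    R.any fun r => decide (r = (e.2, e'.2))))

/-- The three rules are reflexivity, the Euclidean rule and transport along an atom. The first two
give symmetry and transitivity. -/
theorem derivable_iff {d : List Atom} {R : List (Name × Name)} {u v : Name} :
    derivable d R (u, v) = true ↔ u = v ∨ (∃ w, (w, u) ∈ R ∧ (w, v) ∈ R) ∨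
      ∃ A ∈ d, ∃ x y, (u, x) ∈ A ∧ (v, y) ∈ A ∧ (x, y) ∈ R := by
  simp only [derivable, Bool.or_eq_true, Bool.and_eq_true, List.any_eq_true, decide_eq_true_eq,
    Prod.exists]
  refine or_congr Iff.rfl (or_congr ⟨?_, ?_⟩ ⟨?_, ?_⟩)
  · rintro ⟨a, b, h, a', b', h', rfl, rfl, rfl⟩
    exact ⟨a, h, h'⟩
  · rintro ⟨w, h, h'⟩
    exact ⟨w, u, h, w, v, h', rfl, rfl, rfl⟩
  · rintro ⟨A, hA, a, b, h, a', b', h', rfl, rfl, x, y, hR, e⟩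
    exact ⟨A, hA, b, b', h, h', e ▸ hR⟩
  · rintro ⟨A, hA, x, y, h, h', hR⟩
    exact ⟨A, hA, u, x, h, v, y, h', rfl, rfl, x, y, hR, rfl⟩

/-- One round of the computation of the derivable equalities. -/
def deriveRound (d : List Atom) (R : List (Name × Name)) : List (Name × Name) :=
  (namePairs d).filter (derivable d R)

/-- All derivable equalities. -/
def closure (d : List Atom) : List (Name × Name) :=
  (namePairs d).foldl (fun R _ => deriveRound d R) []

/-- The satisfiability test for atoms. -/
def consistent (d : List Atom) : Bool :=
  !(closure d).any fun q => decide (q = (nameFalse, nameTrue))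

theorem foldl_eq_iterate {α β : Type} (f : α → α) (l : List β) (a : α) :
    l.foldl (fun r _ => f r) a = f^[l.length] a := by
  induction l generalizing a with
  | nil => rfl
  | cons b l ih => rw [List.foldl_cons, ih, List.length_cons, Function.iterate_succ_apply]

theorem derivable_mono {d : List Atom} {R R' : List (Name × Name)} (h : R ⊆ R')
    (q : Name × Name) (hq : derivable d R q = true) : derivable d R' q = true := by
  obtain ⟨u, v⟩ := q
  rw [derivable_iff] at hq ⊢
  rcases hq with hq | ⟨w, h1, h2⟩ | ⟨A, hA, x, y, h1, h2, h3⟩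
  · exact .inl hq
  · exact .inr (.inl ⟨w, h h1, h h2⟩)
  · exact .inr (.inr ⟨A, hA, x, y, h1, h2, h h3⟩)

theorem iterate_deriveRound_sublist (d : List Atom) (k : ℕ) :
    ((deriveRound d)^[k] []).Sublist ((deriveRound d)^[k + 1] []) := by
  induction k with
  | zero => exact List.nil_sublist _
  | succ k ih =>
    rw [Function.iterate_succ_apply' _ k, Function.iterate_succ_apply' _ (k + 1)]
    exact List.monotone_filter_right _ (derivable_mono ih.subset)

/-- The rounds form an increasing chain of sublists: once two consecutive ones agree, all later ones
do, and until then every round adds an element. -/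
theorem iterate_deriveRound_stable (d : List Atom) (k : ℕ) :
    (deriveRound d)^[k + 1] [] = (deriveRound d)^[k] [] ∨
      k + 1 ≤ ((deriveRound d)^[k + 1] []).length := by
  have step (k : ℕ) : (deriveRound d)^[k + 1] [] = (deriveRound d)^[k] [] ∨
      ((deriveRound d)^[k] []).length < ((deriveRound d)^[k + 1] []).length := by
    have h := iterate_deriveRound_sublist d k
    rcases h.length_le.lt_or_eq with hlt | he
    · exact .inr hlt
    · exact .inl (h.eq_of_length he).symm
  induction k with
  | zero => exact (step 0).imp_right fun h => Nat.succ_le_of_lt (Nat.zero_lt_of_lt h)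
  | succ k ih =>
    rcases ih with ih | ih
    · left
      rw [Function.iterate_succ_apply' _ (k + 1), ih,
        ← Function.iterate_succ_apply' (deriveRound d) k, ih]
    · exact (step (k + 1)).imp_right fun h => by omega

/-- Every round is a sublist of `namePairs d`, so it cannot grow strictly more often than that list
has elements. `closure` uses the list only as a counter of rounds. -/
theorem deriveRound_closure (d : List Atom) : deriveRound d (closure d) = closure d := by
  rw [closure, foldl_eq_iterate, ← Function.iterate_succ_apply' (deriveRound d)]
  rcases iterate_deriveRound_stable d (namePairs d).length with h | h
  · exact h
  · have h1 : ((deriveRound d)^[(namePairs d).length + 1] []).length ≤ (namePairs d).length := by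
      rw [Function.iterate_succ_apply']
      exact List.length_filter_le _ _
    omega

theorem mem_namePairs {d : List Atom} {u v : Name} :
    (u, v) ∈ namePairs d ↔ u ∈ names d ∧ v ∈ names d := by
  simp [namePairs, List.mem_flatMap]

theorem mem_closure {d : List Atom} {u v : Name} : (u, v) ∈ closure d ↔
    (u ∈ names d ∧ v ∈ names d) ∧ derivable d (closure d) (u, v) = true := by
  conv_lhs => rw [← deriveRound_closure, deriveRound, List.mem_filter, mem_namePairs]

theorem mem_names {d : List Atom} {A : Atom} (hA : A ∈ d) {e : Name × Name} (he : e ∈ A) :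
    e.1 ∈ names d ∧ e.2 ∈ names d := by
  simp only [names, List.mem_cons, List.mem_flatMap]
  exact ⟨.inr (.inr ⟨A, hA, e, he, by simp⟩), .inr (.inr ⟨A, hA, e, he, by simp⟩)⟩

section closure

variable {d : List Atom} {u v w : Name}

theorem closure_refl (h : u ∈ names d) : (u, u) ∈ closure d :=
  mem_closure.2 ⟨⟨h, h⟩, derivable_iff.2 (.inl rfl)⟩

theorem closure_euclid (h₁ : (w, u) ∈ closure d) (h₂ : (w, v) ∈ closure d) :
    (u, v) ∈ closure d :=
  mem_closure.2 ⟨⟨(mem_closure.1 h₁).1.2, (mem_closure.1 h₂).1.2⟩,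
    derivable_iff.2 (.inr (.inl ⟨w, h₁, h₂⟩))⟩

theorem closure_symm (h : (u, v) ∈ closure d) : (v, u) ∈ closure d :=
  closure_euclid h (closure_refl (mem_closure.1 h).1.1)

theorem closure_trans (h₁ : (u, v) ∈ closure d) (h₂ : (v, w) ∈ closure d) :
    (u, w) ∈ closure d :=
  closure_euclid (closure_symm h₁) h₂

theorem closure_atom {A : Atom} (hA : A ∈ d) {e e' : Name × Name} (he : e ∈ A) (he' : e' ∈ A)
    (h : (e.2, e'.2) ∈ closure d) : (e.1, e'.1) ∈ closure d :=
  mem_closure.2 ⟨⟨(mem_names hA he).1, (mem_names hA he').1⟩,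
    derivable_iff.2 (.inr (.inr ⟨A, hA, e.2, e'.2, he, he', h⟩))⟩

end closure

theorem consistent_iff {d : List Atom} :
    consistent d = true ↔ (nameFalse, nameTrue) ∉ closure d := by
  simp only [consistent, Bool.not_eq_true', List.any_eq_false, decide_eq_true_eq]
  exact ⟨fun h h' => h _ h' rfl, fun h q hq e => h (e ▸ hq)⟩

/-! ### Soundness and completeness of the derived equalities -/

/-- The derived equalities hold in every team that satisfies the atoms. -/
theorem value_eq_of_mem_closure {T : Team} {d : List Atom} (h : ∀ A ∈ d, AtomSat T A)
    {u v : Name} (huv : (u, v) ∈ closure d) : ∀ t ∈ T, value t u = value t v := by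
  rw [closure, foldl_eq_iterate] at huv
  generalize (namePairs d).length = k at huv
  induction k generalizing u v with
  | zero => simp at huv
  | succ k ih =>
    rw [Function.iterate_succ_apply', deriveRound, List.mem_filter, derivable_iff] at huv
    intro t ht
    rcases huv.2 with rfl | ⟨w, h1, h2⟩ | ⟨A, hA, x, y, h1, h2, h3⟩
    · rfl
    · exact (ih h1 t ht).symm.trans (ih h2 t ht)
    -- With `t'` the witness of the atom for `t`: `t u = t' x = t' y = t v`.
    · obtain ⟨t', ht', h'⟩ := h A hA t ht
      exact (h' _ h1).trans ((ih h3 t' ht').trans (h' _ h2).symm)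

/-- Assignments may hence be given by arbitrary functions on names, provided that the truth values
are respected. -/
theorem value_of_mem_names {d : List Atom} (hd : ∀ w ∈ names d,
      w = nameTrue ∨ w = nameFalse ∨ Canonical w) {g : Name → Bool} (h₁ : g nameTrue = true)
    (h₀ : g nameFalse = false) {w : Name} (hw : w ∈ names d) :
    value (fun n => g (encodeNat n)) w = g w := by
  rcases hd w hw with rfl | rfl | h
  · simp [h₁]
  · simp [h₀]
  · obtain ⟨n, rfl⟩ := (canonical_iff w).1 h
    simp

theorem exists_team_iff {d : List Atom} (hd : ∀ w ∈ names d,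
      w = nameTrue ∨ w = nameFalse ∨ Canonical w) (hm : ∀ A ∈ d, ∃ l, A = mkAtom l) :
    (∃ T : Team, T.Nonempty ∧ ∀ A ∈ d, AtomSat T A) ↔ consistent d = true := by
  classical
  rw [consistent_iff]
  constructor
  · rintro ⟨T, ⟨t, ht⟩, h⟩ hc
    simpa using value_eq_of_mem_closure h hc t ht
  intro hc
  have hT : nameTrue ∈ names d := by simp [names]
  -- By soundness, every team that satisfies the atoms is contained in this one.
  let T : Team := {t | ∀ u v, (u, v) ∈ closure d → value t u = value t v}
  have mem_T {g : Name → Bool} (h₁ : g nameTrue = true) (h₀ : g nameFalse = false)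
      (h : ∀ u v, (u, v) ∈ closure d → g u = true → g v = true) :
      (fun n => g (encodeNat n)) ∈ T := by
    intro u v huv
    have hn := (mem_closure.1 huv).1
    rw [value_of_mem_names hd h₁ h₀ hn.1, value_of_mem_names hd h₁ h₀ hn.2, Bool.eq_iff_iff]
    exact ⟨h u v huv, h v u (closure_symm huv)⟩
  -- Nonempty: the assignment that is true exactly on the class of `nameTrue`. Consistency is needed
  -- only here, to make it false at `nameFalse`.
  refine ⟨T, ⟨_, mem_T (g := fun z => decide ((nameTrue, z) ∈ closure d)) ?_ ?_ ?_⟩, ?_⟩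
  · simpa using closure_refl hT
  · simpa using fun h => hc (closure_symm h)
  · intro u v huv hu
    simp only [decide_eq_true_eq] at hu ⊢
    exact closure_trans hu huv
  · intro A hA t ht
    obtain ⟨l, hl⟩ := hm A hA
    have hAT : (nameTrue, nameTrue) ∈ A := by simp [hl, mkAtom]
    have hAF : (nameFalse, nameFalse) ∈ A := by simp [hl, mkAtom]
    have h₁ : decide (∃ e ∈ A, (nameTrue, e.2) ∈ closure d ∧ value t e.1 = true) = true := by
      simp only [decide_eq_true_eq]
      exact ⟨_, hAT, closure_refl hT, value_nameTrue t⟩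
    -- If `nameFalse` were equal to some `e.2` with `e.1` true under `t`, the pair of `nameFalse`
    -- with itself in `A` would force `nameFalse = e.1`, which `t` violates.
    have h₀ : decide (∃ e ∈ A, (nameFalse, e.2) ∈ closure d ∧ value t e.1 = true) = false := by
      simp only [decide_eq_false_iff_not]
      rintro ⟨e, he, h1, h2⟩
      have := ht _ _ (closure_atom hA hAF he h1)
      simp [h2] at this
    refine ⟨_, mem_T
      (g := fun z => decide (∃ e ∈ A, (z, e.2) ∈ closure d ∧ value t e.1 = true)) h₁ h₀ ?_, ?_⟩
    · intro u v huv hu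
      simp only [decide_eq_true_eq] at hu ⊢
      obtain ⟨e, he, h1, h2⟩ := hu
      exact ⟨e, he, closure_euclid huv h1, h2⟩
    · intro e he
      rw [value_of_mem_names (g := fun z => decide (∃ e ∈ A, (z, e.2) ∈ closure d ∧
        value t e.1 = true)) hd h₁ h₀ (mem_names hA he).2, Bool.eq_iff_iff]
      simp only [decide_eq_true_eq]
      constructor
      · exact fun h => ⟨e, he, closure_refl (mem_names hA he).2, h⟩
      -- Equal right entries force equal left entries, and `t` respects this.
      · rintro ⟨e', he', h1, h2⟩
        rw [ht _ _ (closure_atom hA he he' h1), h2]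

/-- Supplies the hypotheses of `exists_team_iff`: the truth values are preserved, and all other
names stem from variables. -/
theorem exists_mkAtom_of_mem_atoms : ∀ (φ : PINC), ∀ A ∈ φ.atoms, ∃ l, A = mkAtom l ∧
    ∀ e ∈ l, (e.1 = nameFalse ∨ Canonical e.1) ∧
      (e.2 = nameTrue ∨ e.2 = nameFalse ∨ Canonical e.2)
  | .top => by simp [atoms]
  | .bot => by simp only [atoms, List.mem_singleton, forall_eq]; exact ⟨_, rfl, by simp⟩
  | .pos x => by
    simp only [atoms, List.mem_singleton, forall_eq]
    exact ⟨_, rfl, by simp [canonical_encodeNat]⟩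
  | .neg x => by
    simp only [atoms, List.mem_singleton, forall_eq]
    exact ⟨_, rfl, by simp [canonical_encodeNat]⟩
  | .and φ ψ => by
    simp only [atoms, List.mem_append]
    rintro A (h | h)
    · exact exists_mkAtom_of_mem_atoms φ A h
    · exact exists_mkAtom_of_mem_atoms ψ A h
  | .or φ ψ => by simp [atoms]
  | .inc x y => by
    simp only [atoms, List.mem_singleton, forall_eq]
    exact ⟨_, rfl, by simp [List.mem_ofFn, canonical_encodeNat]⟩

theorem satisfiable_iff_consistent {φ : PINC} (h : φ.splits = 0) :
    φ.Satisfiable ↔ consistent φ.atoms = true := by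
  rw [← exists_team_iff]
  · simp only [Satisfiable, sat_iff_atomSat _ φ h]
  · intro w hw
    simp only [names, List.mem_cons, List.mem_flatMap, List.not_mem_nil, or_false] at hw
    rcases hw with rfl | rfl | ⟨A, hA, e, he, hw⟩
    · exact .inl rfl
    · exact .inr (.inl rfl)
    · obtain ⟨l, rfl, hl⟩ := exists_mkAtom_of_mem_atoms φ A hA
      simp only [mkAtom, List.mem_cons] at he
      rcases he with rfl | rfl | he
      · simp at hw; simp [hw]
      · simp at hw; simp [hw]
      · rcases hw with rfl | rfl
        · exact .inr (hl e he).1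
        · exact (hl e he).2
  · intro A hA
    obtain ⟨l, hl, -⟩ := exists_mkAtom_of_mem_atoms φ A hA
    exact ⟨l, hl⟩

end PINC

/-! ### The parser, which reads the word from right to left -/

namespace PINC

open Computability

/-- The state of the parser: no error occurred; an inclusion atom is open; the first name of the
topmost pair is missing; the pairs of the current atom; the number of complete formulas in unary;
the atoms of the complete formulas. -/
structure ParserState : Type where
  ok : Bool
  inInc : Bool
  odd : Bool
  pend : Atom
  count : List Bool
  atoms : List Atom

namespace ParserState

/-- No atom is open. -/
def idle (s : ParserState) : Bool := s.ok && (!s.inInc && (!s.odd && decide (s.pend = [])))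

/-- Complete an atom. -/
def finish (s : ParserState) (ok : Bool) (A : Atom) : ParserState :=
  ⟨ok, false, false, [], true :: s.count, mkAtom A :: s.atoms⟩

/-- Read a symbol. -/
def step (s : ParserState) : PINCSymbol → ParserState
  | .top => ⟨s.idle, s.inInc, s.odd, s.pend, true :: s.count, s.atoms⟩
  | .bot => s.finish s.idle [(nameFalse, nameTrue)]
  | .pos => match s.pend with
    | [] => ⟨false, s.inInc, s.odd, s.pend, s.count, s.atoms⟩
    | q :: l => s.finish (s.ok && (!s.inInc && (s.odd && decide (l = [])))) [(q.2, nameTrue)]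
  | .neg => match s.pend with
    | [] => ⟨false, s.inInc, s.odd, s.pend, s.count, s.atoms⟩
    | q :: l => s.finish (s.ok && (!s.inInc && (s.odd && decide (l = [])))) [(q.2, nameFalse)]
  | .and => match s.count with
    | [] => ⟨false, s.inInc, s.odd, s.pend, s.count, s.atoms⟩
    | _ :: l => ⟨s.idle && !decide (l = []), s.inInc, s.odd, s.pend, l, s.atoms⟩
  | .or => ⟨false, s.inInc, s.odd, s.pend, s.count, s.atoms⟩
  | .inc => s.finish (s.ok && (s.inInc && !s.odd)) s.pend
  | .bit b => match s.pend with
    | [] => ⟨false, s.inInc, s.odd, s.pend, s.count, s.atoms⟩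
    | q :: l => if s.odd then
        ⟨s.ok && (b || !decide (q.2 = [])), s.inInc, s.odd, (q.1, b :: q.2) :: l, s.count, s.atoms⟩
      else
        ⟨s.ok && (b || !decide (q.1 = [])), s.inInc, s.odd, (b :: q.1, q.2) :: l, s.count, s.atoms⟩
  | .endVar => if s.odd then ⟨s.ok, s.inInc, false, s.pend, s.count, s.atoms⟩
      else ⟨s.ok, s.inInc, true, ([], []) :: s.pend, s.count, s.atoms⟩
  | .endInc => ⟨s.idle, true, s.odd, s.pend, s.count, s.atoms⟩

/-- The initial state. -/
def init : ParserState := ⟨true, false, false, [], [], []⟩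

/-- The state after reading a word from right to left. -/
def run (s : ParserState) (w : List PINCSymbol) : ParserState := w.foldr (fun a s => s.step a) s

theorem run_cons (s : ParserState) (a : PINCSymbol) (w : List PINCSymbol) :
    s.run (a :: w) = (s.run w).step a := rfl

theorem run_append (s : ParserState) (v w : List PINCSymbol) :
    s.run (v ++ w) = (s.run w).run v := List.foldr_append

/-- The word of a name. -/
def nameWord (w : Name) : List PINCSymbol := w.map .bit ++ [.endVar]

theorem nameWord_encodeNat (n : ℕ) : nameWord (encodeNat n) = encodeVar n := rfl

theorem canonical_tail {b : Bool} {w : Name} (h : Canonical (b :: w)) :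
    Canonical w ∧ (b || !decide (w = [])) = true := by
  cases w with
  | nil => simpa [Canonical] using h
  | cons c w =>
    rw [Canonical, List.getLast?_cons_cons] at h
    exact ⟨h, by simp⟩

theorem canonical_cons {b : Bool} {w : Name} (h : Canonical w)
    (h' : (b || !decide (w = [])) = true) : Canonical (b :: w) := by
  cases w with
  | nil => simpa [Canonical] using h'
  | cons c w => rwa [Canonical, List.getLast?_cons_cons]

/-! ### Words of formulas are accepted -/

/-- From the right, the end marker comes first and opens a pair. The next bit is the leading digit,
which must be one; this is the only check for canonicity. -/
theorem run_second (i : Bool) (l : Atom) (c : List Bool) (D : List Atom) (w : Name)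
    (hw : Canonical w) : run ⟨true, i, false, l, c, D⟩ (nameWord w)
      = ⟨true, i, true, ([], w) :: l, c, D⟩ := by
  induction w with
  | nil => rfl
  | cons b w ih =>
    obtain ⟨h1, h2⟩ := canonical_tail hw
    refine (congrArg (fun s => step s (.bit b)) (ih h1)).trans ?_
    simp only [step, if_true, h2, Bool.true_and]

theorem run_first (i : Bool) (v : Name) (l : Atom) (c : List Bool) (D : List Atom) (w : Name)
    (hw : Canonical w) : run ⟨true, i, true, ([], v) :: l, c, D⟩ (nameWord w)
      = ⟨true, i, false, (w, v) :: l, c, D⟩ := by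
  induction w with
  | nil => rfl
  | cons b w ih =>
    obtain ⟨h1, h2⟩ := canonical_tail hw
    refine (congrArg (fun s => step s (.bit b)) (ih h1)).trans ?_
    simp only [step, Bool.false_eq_true, if_false, h2, Bool.true_and]

theorem run_pairs (i : Bool) (c : List Bool) (D : List Atom) (m : List (ℕ × ℕ)) :
    run ⟨true, i, false, [], c, D⟩ (m.map fun q => encodeVar q.1 ++ encodeVar q.2).flatten
      = ⟨true, i, false, m.map fun q => (encodeNat q.1, encodeNat q.2), c, D⟩ := by
  induction m with
  | nil => rfl
  | cons q m ih =>
    rw [List.map_cons, List.flatten_cons, run_append, ih, run_append, ← nameWord_encodeNat,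
      ← nameWord_encodeNat, run_second _ _ _ _ _ (canonical_encodeNat _),
      run_first _ _ _ _ _ _ (canonical_encodeNat _)]
    rfl

/-- Formulas and atoms already read are arbitrary, so that the second argument of a conjunction can
precede the first. -/
theorem run_encode : ∀ φ : PINC, φ.splits = 0 → ∀ (c : List Bool) (D : List Atom),
    run ⟨true, false, false, [], c, D⟩ φ.encode
      = ⟨true, false, false, [], true :: c, φ.atoms ++ D⟩
  | .top, _, c, D => rfl
  | .bot, _, c, D => rfl
  | .pos x, _, c, D => by
    rw [encode, run_cons, ← nameWord_encodeNat, run_second _ _ _ _ _ (canonical_encodeNat _)]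
    rfl
  | .neg x, _, c, D => by
    rw [encode, run_cons, ← nameWord_encodeNat, run_second _ _ _ _ _ (canonical_encodeNat _)]
    rfl
  | .and φ ψ, h, c, D => by
    simp only [splits, Nat.add_eq_zero_iff] at h
    rw [encode, run_cons, run_append, run_encode ψ h.2, run_encode φ h.1, PINC.atoms,
      List.append_assoc]
    rfl
  | .or φ ψ, h, _, _ => by simp [splits] at h
  | .inc x y, _, c, D => by
    have e : (List.ofFn fun i => encodeVar (x i) ++ encodeVar (y i))
        = (List.ofFn fun i => (x i, y i)).map fun q => encodeVar q.1 ++ encodeVar q.2 := by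
      rw [List.map_ofFn]
      rfl
    have h1 : run ⟨true, false, false, [], c, D⟩ [.endInc]
        = ⟨true, true, false, [], c, D⟩ := rfl
    rw [encode, run_cons, run_append, h1, e, run_pairs, List.map_ofFn]
    rfl

/-! ### Accepted words are words of formulas -/

/-- The word of a list of pairs of names. -/
def pairsWord (l : Atom) : List PINCSymbol := l.flatMap fun e => nameWord e.1 ++ nameWord e.2

/-- The part of the current atom that was read. -/
def pendWord (s : ParserState) : List PINCSymbol :=
  match s.odd, s.pend with
  | true, q :: l => nameWord q.2 ++ pairsWord l
  | _, l => pairsWord l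

/-- The state describes a suffix that was read. -/
structure Describes (s : ParserState) (w : List PINCSymbol) : Prop where
  canonical : ∀ e ∈ s.pend, Canonical e.1 ∧ Canonical e.2
  odd : s.odd = true → ∃ v l, s.pend = ([], v) :: l
  formulas : ∃ Φ : List PINC, (∀ φ ∈ Φ, φ.splits = 0) ∧ s.count = List.replicate Φ.length true ∧
    s.atoms = Φ.flatMap PINC.atoms ∧
    w = s.pendWord ++ ((if s.inInc then [.endInc] else []) ++ Φ.flatMap PINC.encode)

theorem idle_iff {s : ParserState} : s.idle = true ↔
    s.ok = true ∧ s.inInc = false ∧ s.odd = false ∧ s.pend = [] := by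
  simp [idle]

theorem exists_pairs {l : Atom} (h : ∀ e ∈ l, Canonical e.1 ∧ Canonical e.2) :
    ∃ m : List (ℕ × ℕ), l = m.map fun q => (encodeNat q.1, encodeNat q.2) := by
  induction l with
  | nil => exact ⟨[], rfl⟩
  | cons e l ih =>
    obtain ⟨m, hm⟩ := ih fun e he => h e (List.mem_cons_of_mem _ he)
    obtain ⟨h1, h2⟩ := h e List.mem_cons_self
    obtain ⟨a, ha⟩ := (canonical_iff _).1 h1
    obtain ⟨b, hb⟩ := (canonical_iff _).1 h2
    exact ⟨(a, b) :: m, by rw [List.map_cons, ← hm, ha, hb]⟩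

theorem exists_inc {l : Atom} (h : ∀ e ∈ l, Canonical e.1 ∧ Canonical e.2) :
    ∃ φ : PINC, φ.splits = 0 ∧ φ.atoms = [mkAtom l] ∧
      φ.encode = .inc :: (pairsWord l ++ [.endInc]) := by
  obtain ⟨m, rfl⟩ := exists_pairs h
  refine ⟨.inc (fun i => (m.get i).1) (fun i => (m.get i).2), rfl, ?_, ?_⟩
  · rw [PINC.atoms]
    congr 2
    conv_rhs => rw [← List.ofFn_get m, List.map_ofFn]
    rfl
  · rw [encode, pairsWord, List.flatMap_map, List.flatMap_def]
    congr 3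
    conv_rhs => rw [← List.ofFn_get m, List.map_ofFn]
    rfl

/-- The common part of all steps that finish an atomic formula: it becomes the new head of the list
of complete formulas. -/
theorem Describes.complete {s : ParserState} {w : List PINCSymbol} (hs : s.Describes w)
    {φ : PINC} (hφ : φ.splits = 0) {D : List Atom} (hD : D = φ.atoms ++ s.atoms)
    {v : List PINCSymbol}
    (hv : φ.encode = v ++ (s.pendWord ++ if s.inInc then [.endInc] else [])) :
    Describes ⟨true, false, false, [], true :: s.count, D⟩ (v ++ w) := by
  obtain ⟨Φ, h1, h2, h3, h4⟩ := hs.formulas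
  refine ⟨by simp, by simp, φ :: Φ, by simpa [hφ] using h1, ?_, ?_, ?_⟩
  · simp [h2, List.replicate_succ]
  · simp [hD, h3]
  · rw [h4, List.flatMap_cons, hv]
    simp [pendWord, pairsWord]

theorem Describes.step {s : ParserState} {w : List PINCSymbol} (hs : s.Describes w)
    (a : PINCSymbol) (ha : (s.step a).ok = true) : (s.step a).Describes (a :: w) := by
  obtain ⟨ok, inInc, odd, pend, count, D⟩ := s
  cases a with
  | top =>
    obtain ⟨h1, h2, h3, h4⟩ := idle_iff.1 ha
    dsimp only at h1 h2 h3 h4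
    subst h1 h2 h3 h4
    exact hs.complete (φ := .top) rfl rfl (v := [.top]) rfl
  | bot =>
    obtain ⟨h1, h2, h3, h4⟩ := idle_iff.1 ha
    dsimp only at h1 h2 h3 h4
    subst h1 h2 h3 h4
    exact hs.complete (φ := .bot) rfl rfl (v := [.bot]) rfl
  | pos =>
    cases pend with
    | nil => simp [ParserState.step] at ha
    | cons q l =>
      simp only [ParserState.step, finish, Bool.and_eq_true, Bool.not_eq_true',
        decide_eq_true_eq] at ha
      obtain ⟨h1, h2, h3, h4⟩ := ha
      subst h1 h2 h3 h4
      obtain ⟨n, hn⟩ := (canonical_iff _).1 (hs.canonical q List.mem_cons_self).2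
      exact hs.complete (φ := .pos n) rfl (by rw [PINC.atoms, hn]; rfl) (v := [.pos]) (by
        simp [encode, pendWord, pairsWord, ← hn, nameWord_encodeNat])
  | neg =>
    cases pend with
    | nil => simp [ParserState.step] at ha
    | cons q l =>
      simp only [ParserState.step, finish, Bool.and_eq_true, Bool.not_eq_true',
        decide_eq_true_eq] at ha
      obtain ⟨h1, h2, h3, h4⟩ := ha
      subst h1 h2 h3 h4
      obtain ⟨n, hn⟩ := (canonical_iff _).1 (hs.canonical q List.mem_cons_self).2
      exact hs.complete (φ := .neg n) rfl (by rw [PINC.atoms, hn]; rfl) (v := [.neg]) (by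
        simp [encode, pendWord, pairsWord, ← hn, nameWord_encodeNat])
  | and =>
    cases count with
    | nil => simp [ParserState.step] at ha
    | cons b l =>
      simp only [ParserState.step, Bool.and_eq_true, Bool.not_eq_true', idle_iff,
        decide_eq_false_iff_not] at ha
      obtain ⟨⟨h1, h2, h3, h4⟩, h5⟩ := ha
      subst h1 h2 h3 h4
      obtain ⟨Φ, h1, h2, h3, h4⟩ := hs.formulas
      -- A valid conjunction step requires two complete formulas; the head of the list is the left
      -- conjunct, being read last.
      match Φ, h1, h2, h3, h4 with
      | [], _, h2, _, _ => simp at h2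
      | [_], _, h2, _, _ => simp [h5] at h2
      | φ :: ψ :: Φ, h1, h2, h3, h4 =>
        simp only [List.forall_mem_cons] at h1
        refine ⟨by simp [ParserState.step], by simp [ParserState.step], .and φ ψ :: Φ, ?_, ?_,
          ?_, ?_⟩
        · simp only [List.forall_mem_cons]
          exact ⟨by simp [splits, h1], h1.2.2⟩
        · simpa [List.replicate_succ, ParserState.step] using (List.cons.inj h2).2
        · simpa [PINC.atoms, ParserState.step] using h3
        · rw [h4]
          simp [pendWord, pairsWord, ParserState.step, encode]
  | or => simp [ParserState.step] at ha
  | inc =>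
    simp only [ParserState.step, finish, Bool.and_eq_true, Bool.not_eq_true'] at ha
    obtain ⟨h1, h2, h3⟩ := ha
    subst h1 h2 h3
    obtain ⟨φ, h1, h2, h3⟩ := exists_inc hs.canonical
    exact hs.complete h1 (by rw [h2]; rfl) (v := [.inc]) (by rw [h3]; rfl)
  | bit b =>
    cases pend with
    | nil => simp [ParserState.step] at ha
    | cons q l =>
      obtain ⟨Φ, h1, h2, h3, h4⟩ := hs.formulas
      have hc := hs.canonical
      simp only [List.forall_mem_cons] at hc
      cases odd with
      | true =>
        simp only [ParserState.step, if_true, Bool.and_eq_true] at ha ⊢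
        obtain ⟨v, l', hl⟩ := hs.odd rfl
        obtain ⟨rfl, rfl⟩ := List.cons.inj hl
        refine ⟨?_, fun _ => ⟨_, _, rfl⟩, Φ, h1, h2, h3, ?_⟩
        · simp only [List.forall_mem_cons]
          exact ⟨⟨hc.1.1, canonical_cons hc.1.2 ha.2⟩, hc.2⟩
        · rw [h4]
          simp [pendWord, nameWord]
      | false =>
        simp only [ParserState.step, Bool.false_eq_true, if_false, Bool.and_eq_true] at ha ⊢
        refine ⟨?_, by simp, Φ, h1, h2, h3, ?_⟩
        · simp only [List.forall_mem_cons]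
          exact ⟨⟨canonical_cons hc.1.1 ha.2, hc.1.2⟩, hc.2⟩
        · rw [h4]
          simp [pendWord, pairsWord, nameWord]
  | endVar =>
    obtain ⟨Φ, h1, h2, h3, h4⟩ := hs.formulas
    cases odd with
    | true =>
      obtain ⟨v, l, hl⟩ := hs.odd rfl
      subst hl
      refine ⟨hs.canonical, by simp [ParserState.step], Φ, h1, h2, h3, ?_⟩
      rw [h4]
      simp [pendWord, pairsWord, nameWord, ParserState.step]
    | false =>
      refine ⟨?_, fun _ => ⟨_, _, rfl⟩, Φ, h1, h2, h3, ?_⟩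
      · simpa [ParserState.step, Canonical] using hs.canonical
      · rw [h4]
        simp [pendWord, pairsWord, nameWord, ParserState.step]
  | endInc =>
    obtain ⟨h1, h2, h3, h4⟩ := idle_iff.1 ha
    dsimp only at h1 h2 h3 h4
    subst h1 h2 h3 h4
    obtain ⟨Φ, h1, h2, h3, h4⟩ := hs.formulas
    refine ⟨hs.canonical, by simp [ParserState.step], Φ, h1, h2, h3, ?_⟩
    rw [h4]
    simp [pendWord, pairsWord, ParserState.step]

/-- Errors are permanent, so the invariant is needed only for states without an error. -/
theorem ok_of_step {s : ParserState} {a : PINCSymbol} (h : (s.step a).ok = true) :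
    s.ok = true := by
  obtain ⟨ok, inInc, odd, pend, count, D⟩ := s
  cases ok with
  | true => rfl
  | false =>
    cases a <;> cases odd <;> cases pend <;> cases count <;>
      simp [step, idle, finish] at h

theorem describes_run : ∀ w : List PINCSymbol, (init.run w).ok = true → (init.run w).Describes w
  | [], _ => ⟨by simp [run, init], by simp [run, init], [], by simp [run, init, pendWord, pairsWord]⟩
  | a :: w, h => (describes_run w (ok_of_step h)).step a h

/-- The decision procedure, applied to the final state of the parser. -/
def accept (s : ParserState) : Bool :=
  s.idle && (decide (s.count = [true]) && consistent s.atoms)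

theorem accept_run_iff (w : List PINCSymbol) :
    (init.run w).accept = true ↔ w ∈ splitFreeSAT := by
  constructor
  · intro h
    simp only [accept, Bool.and_eq_true, decide_eq_true_eq, idle_iff] at h
    obtain ⟨⟨h1, h2, h3, h4⟩, h5, h6⟩ := h
    obtain ⟨Φ, g1, g2, g3, g4⟩ := (describes_run w h1).formulas
    match Φ, g1, g2, g3, g4 with
    | [], _, g2, _, _ => simp [h5] at g2
    | [φ], g1, _, g3, g4 =>
      have hφ : φ.splits = 0 := g1 φ (by simp)
      rw [g3] at h6
      exact ⟨φ, hφ, (satisfiable_iff_consistent hφ).2 (by simpa using h6),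
        by rw [g4]; simp [pendWord, h2, h3, h4, pairsWord]⟩
    | _ :: _ :: _, _, g2, _, _ => simp [h5, List.replicate_succ] at g2
  · rintro ⟨φ, hφ, hs, rfl⟩
    rw [init, run_encode φ hφ]
    simpa [accept, idle] using (satisfiable_iff_consistent hφ).1 hs

end ParserState

end PINC

/-! ### The algorithm runs in polynomial time -/

open StackProg StackProg.Code Computability

namespace StackProg.PolyFun

/-- A chain of equality tests over the finite type; `default` is never reached when the list
contains all elements. -/
theorem finCases {γ σ α : Type} [Code γ] [Code σ] [Code α] [Fintype σ] [DecidableEq σ]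
    [Inhabited α] {f : γ → σ → α} {s : γ → σ} (hf : ∀ a, PolyFun fun c => f c a)
    (hs : PolyFun s) : PolyFun fun c => f c (s c) := by
  have key : ∀ l : List σ, PolyFun fun c => if s c ∈ l then f c (s c) else default := by
    intro l
    induction l with
    | nil => simpa using const (γ := γ) (default : α)
    | cons a l ih =>
      have h := ite (decide_eq hs (const a)) (hf a) ih
      convert h using 2 with c
      by_cases hc : s c = a
      · simp [hc]
      · simp [hc]
  simpa using key Finset.univ.toList

end StackProg.PolyFun

namespace PINC

/-- A binary code of the symbols. -/
def symbolBits : PINCSymbol → List Bool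
  | .top => []
  | .bot => [false]
  | .pos => [true]
  | .neg => [false, false]
  | .and => [false, true]
  | .or => [true, false]
  | .inc => [true, true]
  | .bit b => [false, false, b]
  | .endVar => [false, true, false]
  | .endInc => [false, true, true]

instance : Code PINCSymbol := ⟨fun a => enc (symbolBits a), fun a b h => by
  have h := enc_injective h
  revert h
  cases a <;> cases b <;> simp [symbolBits]⟩

namespace ParserState

/-- The fields of a state. -/
def fields (s : ParserState) : Bool × Bool × Bool × Atom × List Bool × List Atom :=
  (s.ok, s.inInc, s.odd, s.pend, s.count, s.atoms)

instance : Code ParserState := ⟨fun s => enc s.fields, fun s s' h => by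
  have h := enc_injective h
  cases s
  cases s'
  simpa [fields] using h⟩

instance : Inhabited ParserState := ⟨init⟩

section

variable {γ : Type} [Code γ]

theorem polyFun_fields {f : γ → ParserState} (hf : PolyFun f) : PolyFun fun c => (f c).fields :=
  hf

theorem polyFun_mk {a b c : γ → Bool} {d : γ → Atom} {e : γ → List Bool} {g : γ → List Atom}
    (ha : PolyFun a) (hb : PolyFun b) (hc : PolyFun c) (hd : PolyFun d) (he : PolyFun e)
    (hg : PolyFun g) :
    PolyFun fun x => (⟨a x, b x, c x, d x, e x, g x⟩ : ParserState) :=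
  ha.pair (hb.pair (hc.pair (hd.pair (he.pair hg))))

variable {s : γ → ParserState}

theorem polyFun_ok (hs : PolyFun s) : PolyFun fun c => (s c).ok := (polyFun_fields hs).fst

theorem polyFun_inInc (hs : PolyFun s) : PolyFun fun c => (s c).inInc := (polyFun_fields hs).snd.fst

theorem polyFun_odd (hs : PolyFun s) : PolyFun fun c => (s c).odd := (polyFun_fields hs).snd.snd.fst

theorem polyFun_pend (hs : PolyFun s) : PolyFun fun c => (s c).pend :=
  (polyFun_fields hs).snd.snd.snd.fst

theorem polyFun_count (hs : PolyFun s) : PolyFun fun c => (s c).count :=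
  (polyFun_fields hs).snd.snd.snd.snd.fst

theorem polyFun_atoms (hs : PolyFun s) : PolyFun fun c => (s c).atoms :=
  (polyFun_fields hs).snd.snd.snd.snd.snd

theorem polyFun_idle (hs : PolyFun s) : PolyFun fun c => (s c).idle :=
  (polyFun_ok hs).and ((polyFun_inInc hs).not.and ((polyFun_odd hs).not.and
    ((polyFun_pend hs).decide_eq (.const []))))

theorem polyFun_finish {b : γ → Bool} {A : γ → Atom} (hs : PolyFun s)
    (hb : PolyFun b) (hA : PolyFun A) :
    PolyFun fun c => (s c).finish (b c) (A c) :=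
  polyFun_mk hb (.const false) (.const false) (.const []) ((PolyFun.const true).cons
    (polyFun_count hs)) (((PolyFun.const _).cons ((PolyFun.const _).cons hA)).cons
    (polyFun_atoms hs))

theorem polyFun_fail (hs : PolyFun s) : PolyFun fun c =>
    (⟨false, (s c).inInc, (s c).odd, (s c).pend, (s c).count, (s c).atoms⟩ : ParserState) :=
  polyFun_mk (.const false) (polyFun_inInc hs) (polyFun_odd hs) (polyFun_pend hs)
    (polyFun_count hs) (polyFun_atoms hs)

end

theorem polyFun_step (a : PINCSymbol) : PolyFun fun s : ParserState => s.step a := by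
  have hi := polyFun_idle (s := fun s : ParserState => s) .id
  have h2 := polyFun_inInc (s := fun s : ParserState => s) .id
  have h3 := polyFun_odd (s := fun s : ParserState => s) .id
  have h4 := polyFun_pend (s := fun s : ParserState => s) .id
  have h5 := polyFun_count (s := fun s : ParserState => s) .id
  have h6 := polyFun_atoms (s := fun s : ParserState => s) .id
  have hfail := polyFun_fail (s := fun s : ParserState => s) .id
  have hlit (n : Name) : PolyFun fun q : ParserState × (Name × Name) × Atom =>
      q.1.finish (q.1.ok && (!q.1.inInc && (q.1.odd && decide (q.2.2 = [])))) [(q.2.1.2, n)] :=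
    polyFun_finish PolyFun.id.fst ((polyFun_ok PolyFun.id.fst).and
      ((polyFun_inInc PolyFun.id.fst).not.and ((polyFun_odd PolyFun.id.fst).and
        (PolyFun.id.snd.snd.decide_eq (.const [])))))
      ((PolyFun.id.snd.fst.snd.pair (.const n)).cons (.const []))
  cases a with
  | top => exact polyFun_mk hi h2 h3 h4 ((PolyFun.const true).cons h5) h6
  | bot => exact polyFun_finish .id hi (.const _)
  | pos =>
    exact PolyFun.listCases h4 hfail (h := fun (s : ParserState) (q : Name × Name) (l : Atom) =>
      s.finish (s.ok && (!s.inInc && (s.odd && decide (l = [])))) [(q.2, nameTrue)]) (hlit nameTrue)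
      (fun s hs => by simp only [step, hs]) (fun s a t hs => by simp only [step, hs])
  | neg =>
    exact PolyFun.listCases h4 hfail (h := fun (s : ParserState) (q : Name × Name) (l : Atom) =>
      s.finish (s.ok && (!s.inInc && (s.odd && decide (l = [])))) [(q.2, nameFalse)])
      (hlit nameFalse)
      (fun s hs => by simp only [step, hs]) (fun s a t hs => by simp only [step, hs])
  | and =>
    exact PolyFun.listCases h5 hfail
      (h := fun (s : ParserState) (_ : Bool) (l : List Bool) =>
        (⟨s.idle && !decide (l = []), s.inInc, s.odd, s.pend, l, s.atoms⟩ :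
        ParserState))
      (polyFun_mk ((polyFun_idle PolyFun.id.fst).and
        (PolyFun.id.snd.snd.decide_eq (.const [])).not) (polyFun_inInc PolyFun.id.fst)
        (polyFun_odd PolyFun.id.fst) (polyFun_pend PolyFun.id.fst) PolyFun.id.snd.snd
        (polyFun_atoms PolyFun.id.fst))
      (fun s hs => by simp only [step, hs]) (fun s a t hs => by simp only [step, hs])
  | or => exact hfail
  | inc =>
    exact polyFun_finish .id ((polyFun_ok PolyFun.id).and (h2.and h3.not)) h4
  | bit b =>
    refine PolyFun.listCases h4 hfail
      (h := fun (s : ParserState) (q : Name × Name) (l : Atom) => if s.odd then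
        (⟨s.ok && (b || !decide (q.2 = [])), s.inInc, s.odd, (q.1, b :: q.2) :: l, s.count,
          s.atoms⟩ : ParserState)
      else
        ⟨s.ok && (b || !decide (q.1 = [])), s.inInc, s.odd, (b :: q.1, q.2) :: l, s.count,
          s.atoms⟩) ((polyFun_odd PolyFun.id.fst).ite ?_ ?_)
      (fun s hs => by simp only [step, hs]) (fun s a t hs => by simp only [step, hs])
    · exact polyFun_mk ((polyFun_ok PolyFun.id.fst).and ((PolyFun.const b).or
        (PolyFun.id.snd.fst.snd.decide_eq (.const [])).not)) (polyFun_inInc PolyFun.id.fst)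
        (polyFun_odd PolyFun.id.fst) ((PolyFun.id.snd.fst.fst.pair
          ((PolyFun.const b).cons PolyFun.id.snd.fst.snd)).cons PolyFun.id.snd.snd)
        (polyFun_count PolyFun.id.fst) (polyFun_atoms PolyFun.id.fst)
    · exact polyFun_mk ((polyFun_ok PolyFun.id.fst).and ((PolyFun.const b).or
        (PolyFun.id.snd.fst.fst.decide_eq (.const [])).not)) (polyFun_inInc PolyFun.id.fst)
        (polyFun_odd PolyFun.id.fst) ((((PolyFun.const b).cons PolyFun.id.snd.fst.fst).pair
          PolyFun.id.snd.fst.snd).cons PolyFun.id.snd.snd)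
        (polyFun_count PolyFun.id.fst) (polyFun_atoms PolyFun.id.fst)
  | endVar =>
    exact h3.ite (polyFun_mk (polyFun_ok PolyFun.id) h2 (.const false) h4 h5 h6)
      (polyFun_mk (polyFun_ok PolyFun.id) h2 (.const true) ((PolyFun.const _).cons h4) h5 h6)
  | endInc => exact polyFun_mk hi (.const true) h3 h4 h5 h6

/-! ### Linear growth of the parser state -/

/-- The size of the lists in a state. -/
def weight (s : ParserState) : ℕ := size s.pend + size s.count + size s.atoms

theorem size_le_weight (s : ParserState) : size s ≤ s.weight + 14 := by
  have h1 := size_bool_le s.ok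
  have h2 := size_bool_le s.inInc
  have h3 := size_bool_le s.odd
  have e : size s = size s.ok + (size s.inInc + (size s.odd + (size s.pend +
    (size s.count + size s.atoms + 1) + 1) + 1) + 1) + 1 := rfl
  rw [e, weight]
  omega

/-- A step moves data from one list to another and adds boundedly many nodes, without copying; 60 is
a generous bound. Iteration therefore gives linear growth. -/
theorem weight_step_le (s : ParserState) (a : PINCSymbol) : (s.step a).weight ≤ s.weight + 60 := by
  have ht : size nameTrue = 3 := rfl
  have hf : size nameFalse = 5 := rfl
  have hb (b : Bool) := size_bool_le b
  have hm (l : Atom) : size (mkAtom l) = size l + 20 := by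
    simp only [mkAtom, size_cons, size_pair, ht, hf]
    omega
  have ha (b : Bool) (l : List Bool) : size (b :: l) ≤ size l + 4 := by
    have := hb b
    rw [size_cons]
    omega
  obtain ⟨ok, inInc, odd, pend, count, D⟩ := s
  have hc := ha true count
  cases a with
  | top => simp only [step, weight]; omega
  | bot | inc =>
    simp only [step, finish, weight, hm, size_cons, size_pair, size_nil, ht, hf] at hc ⊢
    omega
  | pos | neg =>
    cases pend with
    | nil => simp only [step, weight]; omega
    | cons q l =>
      have := BTree.one_le_size (enc q.1)
      have e : size q = size q.1 + size q.2 + 1 := rfl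
      simp only [step, finish, weight, hm, size_cons, size_pair, size_nil, ht, hf] at hc e ⊢
      omega
  | and =>
    cases count with
    | nil => simp only [step, weight]; omega
    | cons b l => simp only [step, weight, size_cons]; omega
  | or | endInc => simp only [step, weight]; omega
  | bit b =>
    cases pend with
    | nil => simp only [step, weight]; omega
    | cons q l =>
      have e : size q = size q.1 + size q.2 + 1 := rfl
      have h1 := ha b q.1
      have h2 := ha b q.2
      cases odd <;>
      · simp only [step, weight, if_true, Bool.false_eq_true, if_false, size_cons, size_pair] at *
        omega
  | endVar =>
    cases odd <;>
    · simp only [step, weight, if_true, Bool.false_eq_true, if_false, size_cons, size_pair,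
        size_nil]
      omega

theorem polyFun_run : PolyFun fun w : List PINCSymbol => w.foldl step init := by
  have hw : ∀ (w : List PINCSymbol) (s : ParserState),
      (w.foldl step s).weight ≤ s.weight + 60 * w.length := by
    intro w
    induction w with
    | nil => simp
    | cons a w ih =>
      intro s
      have h1 := ih (s.step a)
      have h2 := weight_step_le s a
      rw [List.foldl_cons, List.length_cons]
      omega
  refine PolyFun.foldl (h := fun _ => step) .id (.const init)
    (PolyFun.finCases (f := fun (q : List PINCSymbol × ParserState × PINCSymbol) a => q.2.1.step a)
      (fun a => (polyFun_step a).comp PolyFun.id.snd.fst) PolyFun.id.snd.snd)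
    -- The constant is 14 from `size_le_weight` plus 3 for the empty lists of the initial state.
    (60 * .X + 17) fun w k => ?_
  have h1 := size_le_weight ((w.take k).foldl step init)
  have h2 := hw (w.take k) init
  have h3 := length_lt_size w
  have h4 : (w.take k).length ≤ w.length := List.length_take_le' _ _
  have h5 : init.weight = 3 := rfl
  simp only [Polynomial.eval_add, Polynomial.eval_mul, Polynomial.eval_X, Polynomial.eval_ofNat]
  omega

end ParserState

/-! ### Polynomial time for the consistency test -/

theorem polyFun_names : PolyFun names := by
  have h1 : PolyFun fun q : List Atom × Atom => q.2.flatMap fun e => [e.1, e.2] :=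
    PolyFun.flatMap (g := fun (_ : List Atom × Atom) (e : Name × Name) => [e.1, e.2])
      PolyFun.id.snd (PolyFun.id.snd.fst.cons (PolyFun.id.snd.snd.cons (.const [])))
  exact (PolyFun.const _).cons ((PolyFun.const _).cons (PolyFun.flatMap (l := fun d => d)
    (g := fun (_ : List Atom) (A : Atom) => A.flatMap fun e => [e.1, e.2]) .id h1))

theorem polyFun_namePairs : PolyFun namePairs := by
  have h1 : PolyFun fun q : List Atom × Name => (names q.1).map fun v => (q.2, v) :=
    PolyFun.map (g := fun (q : List Atom × Name) v => (q.2, v)) (polyFun_names.comp PolyFun.id.fst)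
      (PolyFun.id.fst.snd.pair PolyFun.id.snd)
  exact PolyFun.flatMap (g := fun (d : List Atom) u => (names d).map fun v => (u, v))
    polyFun_names h1

/-- The arguments of `derivable`. -/
abbrev DeriveInput : Type := (List Atom × List (Name × Name)) × (Name × Name)

/-- A `PolyFun` has a single argument, so each inner quantifier is treated with the outer bound
variables packed into a tuple. -/
theorem polyFun_derivable_euclid : PolyFun fun q : DeriveInput => q.1.2.any fun r => q.1.2.any
    fun r' => decide (r.1 = r'.1) && (decide (r.2 = q.2.1) && decide (r'.2 = q.2.2)) := by
  have h1 : PolyFun fun x : (DeriveInput × (Name × Name)) × (Name × Name) =>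
      decide (x.1.2.1 = x.2.1) && (decide (x.1.2.2 = x.1.1.2.1) && decide (x.2.2 = x.1.1.2.2)) :=
    (PolyFun.id.fst.snd.fst.decide_eq PolyFun.id.snd.fst).and
      ((PolyFun.id.fst.snd.snd.decide_eq PolyFun.id.fst.fst.snd.fst).and
        (PolyFun.id.snd.snd.decide_eq PolyFun.id.fst.fst.snd.snd))
  have h2 : PolyFun fun x : DeriveInput × (Name × Name) => x.1.1.2.any
      fun r' => decide (x.2.1 = r'.1) && (decide (x.2.2 = x.1.2.1) && decide (r'.2 = x.1.2.2)) :=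
    PolyFun.any (p := fun (x : DeriveInput × (Name × Name)) (r' : Name × Name) =>
      decide (x.2.1 = r'.1) && (decide (x.2.2 = x.1.2.1) && decide (r'.2 = x.1.2.2)))
      PolyFun.id.fst.fst.snd h1
  exact PolyFun.any (p := fun (q : DeriveInput) (r : Name × Name) => q.1.2.any
    fun r' => decide (r.1 = r'.1) && (decide (r.2 = q.2.1) && decide (r'.2 = q.2.2)))
    PolyFun.id.fst.snd h2

theorem polyFun_derivable_atom : PolyFun fun q : DeriveInput => q.1.1.any fun A => A.any
    fun e => A.any fun e' => decide (e.1 = q.2.1) && (decide (e'.1 = q.2.2) &&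
      q.1.2.any fun r => decide (r = (e.2, e'.2))) := by
  have h1 : PolyFun fun z : ((DeriveInput × Atom) × (Name × Name)) × (Name × Name) =>
      z.1.1.1.1.2.any fun r => decide (r = (z.1.2.2, z.2.2)) :=
    PolyFun.any
      (p := fun (z : ((DeriveInput × Atom) × (Name × Name)) × (Name × Name)) (r : Name × Name) =>
        decide (r = (z.1.2.2, z.2.2))) PolyFun.id.fst.fst.fst.fst.snd
      (PolyFun.id.snd.decide_eq (PolyFun.id.fst.fst.snd.snd.pair PolyFun.id.fst.snd.snd))
  have h2 : PolyFun fun y : (DeriveInput × Atom) × (Name × Name) => y.1.2.any fun e' =>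
      decide (y.2.1 = y.1.1.2.1) && (decide (e'.1 = y.1.1.2.2) &&
        y.1.1.1.2.any fun r => decide (r = (y.2.2, e'.2))) :=
    PolyFun.any (p := fun (y : (DeriveInput × Atom) × (Name × Name)) (e' : Name × Name) =>
      decide (y.2.1 = y.1.1.2.1) && (decide (e'.1 = y.1.1.2.2) &&
        y.1.1.1.2.any fun r => decide (r = (y.2.2, e'.2)))) PolyFun.id.fst.snd
      ((PolyFun.id.fst.snd.fst.decide_eq PolyFun.id.fst.fst.fst.snd.fst).and
        ((PolyFun.id.snd.fst.decide_eq PolyFun.id.fst.fst.fst.snd.snd).and h1))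
  have h3 : PolyFun fun x : DeriveInput × Atom => x.2.any fun e => x.2.any fun e' =>
      decide (e.1 = x.1.2.1) && (decide (e'.1 = x.1.2.2) &&
        x.1.1.2.any fun r => decide (r = (e.2, e'.2))) :=
    PolyFun.any (p := fun (x : DeriveInput × Atom) (e : Name × Name) => x.2.any fun e' =>
      decide (e.1 = x.1.2.1) && (decide (e'.1 = x.1.2.2) &&
        x.1.1.2.any fun r => decide (r = (e.2, e'.2)))) PolyFun.id.snd h2
  exact PolyFun.any (p := fun (q : DeriveInput) (A : Atom) => A.any fun e => A.any fun e' =>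
      decide (e.1 = q.2.1) && (decide (e'.1 = q.2.2) &&
        q.1.2.any fun r => decide (r = (e.2, e'.2)))) PolyFun.id.fst.fst h3

theorem polyFun_derivable : PolyFun fun q : DeriveInput => derivable q.1.1 q.1.2 q.2 :=
  (PolyFun.id.snd.fst.decide_eq PolyFun.id.snd.snd).or
    (polyFun_derivable_euclid.or polyFun_derivable_atom)

theorem polyFun_deriveRound :
    PolyFun fun q : List Atom × List (Name × Name) => deriveRound q.1 q.2 :=
  PolyFun.filter (p := fun (q : List Atom × List (Name × Name)) => derivable q.1 q.2)
    (polyFun_namePairs.comp PolyFun.id.fst) polyFun_derivable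

theorem polyFun_closure : PolyFun closure := by
  obtain ⟨Q, hQ⟩ := polyFun_namePairs.size_le
  refine PolyFun.foldl (h := fun (d : List Atom) R (_ : Name × Name) => deriveRound d R)
    polyFun_namePairs (.const []) (polyFun_deriveRound.comp
      -- Each round filters `namePairs d`, so the intermediate sizes do not accumulate; the summand
      -- 1 covers the initial empty list.
      (PolyFun.id.fst.pair PolyFun.id.snd.fst)) (Q + 1) fun d k => ?_
  rw [foldl_eq_iterate, Polynomial.eval_add, Polynomial.eval_one]
  have h := hQ d
  cases ((namePairs d).take k).length with
  | zero => simp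
  | succ n =>
    rw [Function.iterate_succ_apply']
    exact (size_le_of_sublist List.filter_sublist).trans (h.trans (Nat.le_succ _))

theorem polyFun_consistent : PolyFun consistent :=
  (PolyFun.any (p := fun (_ : List Atom) (q : Name × Name) =>
    decide (q = (nameFalse, nameTrue))) polyFun_closure
    (PolyFun.id.snd.decide_eq (.const _))).not

theorem polyFun_accept : PolyFun fun s : ParserState => s.accept :=
  (ParserState.polyFun_idle .id).and (((ParserState.polyFun_count .id).decide_eq
    (.const [true])).and (polyFun_consistent.comp (ParserState.polyFun_atoms .id)))

end PINC

theorem mainTheorem3 : InPTime PINC.splitFreeSAT := by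
  refine inPTime_of_polyFun (PINC.polyFun_accept.comp PINC.ParserState.polyFun_run) fun w => ?_
  -- A left fold over the reversed input is the right-to-left run of the parser.
  rw [List.foldl_reverse]
  exact PINC.ParserState.accept_run_iff w
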